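/- Let $k$ be an algebraically closed field of characteristic zero and let $H$ be a Hopf algebra over $k$. Let $G(H)$ be the group of group-like elements of $H$ and let $C_0=kG(H)$ be its linear span. For $g\in G(H)$, a nonzero element $y\in H$ is called skew primitive of weight $\mu(y)=g$ if $\Delta(y)=y\otimes 1+g\otimes y$. Let $y_1,y_2\in H$ be two skew primitive elements whose images in the quotient space $H/C_0$ are linearly independent. Suppose that there are a group-like element $x\in G(H)$, integers $d_1,d_2\in\mathbb Z$ and scalars $q_1,q_2\in k^\times$ such that, for $i=1,2$, $\mu(y_i)=x^{d_i}$ and $y_i x=q_i\,x y_i$. (a) If $x$ has infinite order and $H$ does not contain a free $k$-subalgebra of rank $2$, then $$q_1^{\,d_1M_1(M_1-1)+d_2M_1M_2}\;q_2^{\,d_2M_2(M_2-1)+d_1M_1M_2}=1$$ for some integers $M_1,M_2\ge 0$ with $M_1+M_2\ge 2$. (b) Assume that one of the following holds: 1. $q_1=q_2$ is not a root of unity and $d_1d_2>0$; 2. $q_1^{d_1}=1$, $q_2$ is not a root of unity, and $d_1d_2>0$; 3. $q_1^{d_1}\ne 1$ is a root of unity, $q_2$ is not a root of unity, and $d_1d_2>0$;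 4. the subgroup $\langle q_1,q_2\rangle\subset k^\times$ is free abelian of rank $2$, and $d_1d_2\neq 0$. Then $H$ contains a free $k$-subalgebra of rank $2$. Consequently $H$ has exponential growth, i.e. there are a finite-dimensional subspace $V\subset H$ and a real number $c>1$ such that $\dim_k(k+V+V^2+\cdots+V^n)\ge c^n$ for all sufficiently large $n$. -/

import Mathlib

open scoped TensorProduct

/-- A skew primitive element of weight `g`: a nonzero `y` with `Δ(y) = y ⊗ 1 + g ⊗ y`,
where `g` is group-like. -/
structure IsSkewPrimitive (k : Type*) {H : Type*} [Field k] [Ring H] [HopfAlgebra k H]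
    (g : GroupLike k H) (y : H) : Prop where
  ne_zero : y ≠ 0
  comul_eq : Coalgebra.comul (R := k) y = y ⊗ₜ[k] 1 + g.val ⊗ₜ[k] y

/-- The subspace `C₀ = k G(H)` of `H` spanned by the group-like elements. -/
def groupLikeSpan (k H : Type*) [Field k] [Ring H] [HopfAlgebra k H] : Submodule k H :=
  Submodule.span k {a : H | IsGroupLikeElem k a}

/-- `H` contains a free `k`-subalgebra of rank 2: two elements of `H` generate a subalgebra
in which they are free generators. -/
def HasFreeSubalgebraRankTwo (k H : Type*) [Field k] [Ring H] [Algebra k H] : Prop :=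
  ∃ a b : H, Function.Injective (FreeAlgebra.lift k ![a, b])

/-- Exponential growth of a (not necessarily finitely generated) algebra `H`: for some
finite-dimensional subspace `V`, the growth function `n ↦ dim (k + V + V² + ⋯ + Vⁿ)`
is eventually bounded below by `cⁿ` for some `c > 1`. Here `(1 ⊔ V) ^ n` is the subspace
`(k + V)ⁿ = k + V + ⋯ + Vⁿ`. -/
def HasExponentialGrowth (k H : Type*) [Field k] [Ring H] [Algebra k H] : Prop :=
  ∃ V : Submodule k H, FiniteDimensional k V ∧
    ∃ c : ℝ, 1 < c ∧ ∀ᶠ n : ℕ in Filter.atTop,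
      c ^ n ≤ (Module.finrank k ((1 ⊔ V) ^ n : Submodule k H) : ℝ)

/-- A scalar `q ∈ kˣ` is a root of unity. -/
def IsUnityRoot {k : Type*} [Field k] (q : kˣ) : Prop :=
  ∃ n : ℕ, 0 < n ∧ q ^ n = 1

/-- The subgroup of `kˣ` generated by `q₁` and `q₂` is a free abelian group of rank 2. -/
def GeneratesFreeAbelianRankTwo {k : Type*} [Field k] (q₁ q₂ : kˣ) : Prop :=
  Module.Free ℤ (Additive (Subgroup.closure {q₁, q₂} : Subgroup kˣ)) ∧
    Module.finrank ℤ (Additive (Subgroup.closure {q₁, q₂} : Subgroup kˣ)) = 2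

/-! Filter by word length: in degree `n`, work modulo $C_0$ and all products of a power of $x$ with
a shorter word in the $y_i$. Collecting group-like factors gives an explicit coproduct on formal
words (`wordComul`). Suppose a combination $R$ of words of length $n\ge 2$ falls into the lower
filtration. Words of smaller positive length are already independent, so functionals separate them
and all mixed terms of the formal coproduct of $R$ must vanish (`IndepInDegree.step`). Degree one
holds because the $y_i$ are independent modulo $C_0$ and $x$ has infinite order.

For such $R$ the antipode axiom collapses to a relation between the coefficients of $w$ and of its
reversal. Using it twice shows that every $w$ in the support has a twist, essentially the scalar of
$S^2$, equal to 1 (`IsRelPrimitive.antipodeCoeff_mul`). The twist depends only on the letter counts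
$M_1,M_2$, and its inverse is the product in (a). If no such product is 1, the words are independent
and $y_1,y_2$ are free generators; this gives (a), and with some arithmetic (b1) and (b4).

In (b2) and (b3) only powers of $y_1$ can have twist 1. A multiple of $y_1^n$ is excluded when the
quantum integer $[n]$ at $Q=q_1^{d_1}$ is nonzero, which settles $Q=1$ in characteristic zero. If
$Q\ne1$ has order $N$, then $y_1^N$ satisfies the skew primitive identity. If it lies outside $C_0$,
it replaces $y_1$ and reduces to $Q=1$. Otherwise it lies in the span of $1$ and $x^{Nd_1}$; words
avoiding $y_1^N$ are independent, and $y_2,\ y_1y_2$ are free generators. -/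

/-! ### Formal coproduct and antipode on words -/

section WordCombinatorics

variable {k ι : Type*} [Field k]

/-- The total weight of a word. -/
def wordWeight (d : ι → ℤ) (w : List ι) : ℤ := (w.map d).sum

@[simp] lemma wordWeight_nil (d : ι → ℤ) : wordWeight d [] = 0 := rfl

@[simp] lemma wordWeight_cons (d : ι → ℤ) (i : ι) (w : List ι) :
    wordWeight d (i :: w) = d i + wordWeight d w := by simp [wordWeight]

@[simp] lemma wordWeight_append (d : ι → ℤ) (u v : List ι) :
    wordWeight d (u ++ v) = wordWeight d u + wordWeight d v := by simp [wordWeight]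

@[simp] lemma wordWeight_reverse (d : ι → ℤ) (w : List ι) :
    wordWeight d w.reverse = wordWeight d w := by simp [wordWeight, List.sum_reverse]

/-- The effect on formal coproducts of multiplying a word by the letter `i` on the left. -/
noncomputable def consComul (q : ι → kˣ) (d : ι → ℤ) (i : ι) :
    (List ι × List ι →₀ k) →ₗ[k] (List ι × List ι →₀ k) :=
  Finsupp.linearCombination k fun p =>
    Finsupp.single (i :: p.1, p.2) ((q i ^ wordWeight d p.2 : kˣ) : k) +
      Finsupp.single (p.1, i :: p.2) 1

/-- The formal coproduct of a word of skew primitive letters `y i` of weight `x ^ d i` with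
`y i * x = q i • (x * y i)`: the coefficient at `(u, v)` is that of `x ^ wordWeight d v * u ⊗ v`. -/
noncomputable def wordComul (q : ι → kˣ) (d : ι → ℤ) : List ι → (List ι × List ι →₀ k)
  | [] => Finsupp.single ([], []) 1
  | i :: w => consComul q d i (wordComul q d w)

/-- The formal coproduct of a linear combination of words. -/
noncomputable def formalComul (q : ι → kˣ) (d : ι → ℤ) :
    (List ι →₀ k) →ₗ[k] (List ι × List ι →₀ k) :=
  Finsupp.linearCombination k (wordComul q d)

/-- The coefficient of the reversed word in the antipode of a word. -/
def antipodeCoeff (q : ι → kˣ) (d : ι → ℤ) : List ι → ℤ → kˣ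
  | [], _ => 1
  | i :: u, m => -(q i ^ m)⁻¹ * antipodeCoeff q d u (m + d i)

/-- The map `u ⊗ v ↦ S(u) v` on words. -/
noncomputable def antipodeMul (q : ι → kˣ) (d : ι → ℤ) :
    (List ι × List ι →₀ k) →ₗ[k] (List ι →₀ k) :=
  Finsupp.linearCombination k fun p =>
    Finsupp.single (p.1.reverse ++ p.2) (antipodeCoeff q d p.1 (wordWeight d p.2) : k)

/-- The new letter sits at the junction of $S(u)$ and $v$, so both terms give the same word; the
recursion for `antipodeCoeff` makes their coefficients opposite. -/
lemma antipodeMul_consComul (q : ι → kˣ) (d : ι → ℤ) (i : ι) (z : List ι × List ι →₀ k) :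
    antipodeMul q d (consComul q d i z) = 0 := by
  induction z using Finsupp.induction_linear with
  | zero => simp
  | add f g hf hg => simp [hf, hg]
  | single p c =>
    simp only [consComul, antipodeMul, Finsupp.linearCombination_single, map_smul, map_add,
      List.reverse_cons, List.append_assoc, List.singleton_append, wordWeight_cons,
      Finsupp.smul_single, ← Finsupp.single_add]
    rw [Finsupp.single_eq_zero]
    simp [antipodeCoeff, add_comm (d i), mul_inv_cancel_left₀ (zpow_ne_zero _ (q i).ne_zero)]

lemma antipodeMul_formalComul (q : ι → kˣ) (d : ι → ℤ) (R : List ι →₀ k) (hR : R [] = 0) :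
    antipodeMul q d (formalComul q d R) = 0 := by
  simp only [formalComul, Finsupp.linearCombination_apply, Finsupp.sum, map_sum, map_smul]
  refine Finset.sum_eq_zero fun w hw => ?_
  cases w with
  | nil => simp [hR] at hw
  | cons i w => simp [wordComul, antipodeMul_consComul]

lemma consComul_apply_nil_left (q : ι → kˣ) (d : ι → ℤ) (i : ι) (z : List ι × List ι →₀ k)
    (v : List ι) [DecidableEq ι] : consComul q d i z ([], v) =
      match v with
      | [] => 0
      | j :: v => if i = j then z ([], v) else 0 := by
  induction z using Finsupp.induction_linear with
  | zero => cases v <;> simp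
  | add f g hf hg => cases v <;> simp_all; split_ifs <;> simp
  | single p c =>
    obtain ⟨u', v'⟩ := p
    cases v <;> simp [consComul, Finsupp.single_apply]
    split_ifs <;> simp_all

lemma consComul_apply_cons_left (q : ι → kˣ) (d : ι → ℤ) (i j : ι) (z : List ι × List ι →₀ k)
    (u v : List ι) [DecidableEq ι] : consComul q d i z (j :: u, v) =
      (if i = j then ((q i ^ wordWeight d v : kˣ) : k) * z (u, v) else 0) +
      match v with
      | [] => 0
      | l :: v => if i = l then z (j :: u, v) else 0 := by
  induction z using Finsupp.induction_linear with
  | zero => cases v <;> simp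
  | add f g hf hg => cases v <;> simp_all <;> split_ifs <;> ring
  | single p c =>
    obtain ⟨u', v'⟩ := p
    cases v <;> simp [consComul, Finsupp.single_apply] <;> split_ifs <;> simp_all [mul_comm]

lemma wordComul_nil_left (q : ι → kˣ) (d : ι → ℤ) [DecidableEq ι] (w v : List ι) :
    wordComul q d w ([], v) = if w = v then 1 else 0 := by
  induction w generalizing v with
  | nil => cases v <;> simp [wordComul]
  | cons i w ih => cases v <;> simp [wordComul, consComul_apply_nil_left, ih]; grind

lemma wordComul_nil_right (q : ι → kˣ) (d : ι → ℤ) [DecidableEq ι] (w u : List ι) :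
    wordComul q d w (u, []) = if w = u then 1 else 0 := by
  induction w generalizing u with
  | nil => cases u <;> simp [wordComul]
  | cons i w ih =>
    cases u <;> simp [wordComul, consComul_apply_nil_left, consComul_apply_cons_left, ih]; grind

lemma length_add_length_of_wordComul_ne_zero (q : ι → kˣ) (d : ι → ℤ) {w u v : List ι}
    (h : wordComul q d w (u, v) ≠ 0) : u.length + v.length = w.length := by
  classical
  induction w generalizing u v with
  | nil => simp [wordComul, Finsupp.single_apply] at h; simp [h]
  | cons i w ih =>
    cases u with
    | nil =>
      rw [wordComul_nil_left] at h
      simp_all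
    | cons j u =>
      rw [wordComul, consComul_apply_cons_left] at h
      by_cases h1 : wordComul q d w (u, v) = 0
      · cases v with
        | nil => simp [h1] at h
        | cons l v =>
          simp only [h1] at h
          have := @ih (j :: u) v (by intro h2; simp [h2] at h)
          simp at this ⊢; omega
      · have := ih h1
        simp; omega

lemma formalComul_nil_left (q : ι → kˣ) (d : ι → ℤ) (R : List ι →₀ k) (v : List ι) :
    formalComul q d R ([], v) = R v := by
  classical
  simp [formalComul, Finsupp.linearCombination_apply, Finsupp.sum, Finsupp.finsetSum_apply,
    wordComul_nil_left, eq_comm]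

lemma formalComul_nil_right (q : ι → kˣ) (d : ι → ℤ) (R : List ι →₀ k) (u : List ι) :
    formalComul q d R (u, []) = R u := by
  classical
  simp [formalComul, Finsupp.linearCombination_apply, Finsupp.sum, Finsupp.finsetSum_apply,
    wordComul_nil_right, eq_comm]

/-- A linear combination of words is *primitive relative to* `P` if the mixed terms of its formal
coproduct vanish at all pairs of nonempty words satisfying `P`. -/
def IsRelPrimitive (q : ι → kˣ) (d : ι → ℤ) (P : List ι → Prop) (R : List ι →₀ k) : Prop :=
  ∀ u v, u ≠ [] → v ≠ [] → P u → P v → formalComul q d R (u, v) = 0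

/-- Read the coefficient at `w` in the antipode identity. A pair `(u, v)` contributes only if
`u.reverse ++ v = w`; closure of `P` under factors and reversal then puts both parts in `P`, so
mixed pairs vanish and only the two extreme ones remain. -/
lemma IsRelPrimitive.apply_add {q : ι → kˣ} {d : ι → ℤ} {P : List ι → Prop} {R : List ι →₀ k}
    (h : IsRelPrimitive q d P R) (hrev : ∀ w, P w → P w.reverse)
    (happ : ∀ u v, P (u ++ v) → P u ∧ P v) (hR : R [] = 0) {w : List ι} (hw : w ≠ []) (hP : P w) :
    R w + R w.reverse * antipodeCoeff q d w.reverse 0 = 0 := by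
  classical
  have h0 := DFunLike.congr_fun (antipodeMul_formalComul q d R hR) w
  rw [antipodeMul, Finsupp.linearCombination_apply, Finsupp.sum, Finsupp.finsetSum_apply] at h0
  -- The sum passes through the intersection because the two extreme pairs need not lie in the
  -- support.
  rw [← Finset.sum_subset (s₁ := (formalComul q d R).support ∩ {([], w), (w.reverse, [])})
    Finset.inter_subset_left] at h0
  · rw [Finset.sum_subset (s₂ := {([], w), (w.reverse, [])}) Finset.inter_subset_right,
      Finset.sum_pair (by simp [hw])] at h0
    · simpa [formalComul_nil_left, formalComul_nil_right, antipodeCoeff] using h0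
    · intro p hp hp'
      have : formalComul q d R p = 0 := by
        by_contra hne
        exact hp' (Finset.mem_inter.2 ⟨Finsupp.mem_support_iff.2 hne, hp⟩)
      simp [this]
  · rintro ⟨u, v⟩ hp hp'
    by_cases huv : u.reverse ++ v = w
    · obtain ⟨hu, hv⟩ := happ _ _ (huv ▸ hP)
      have hu := hrev _ hu
      rw [List.reverse_reverse] at hu
      by_cases hu0 : u = []
      · subst hu0
        simp at huv
        simp_all
      by_cases hv0 : v = []
      · subst hv0
        simp at huv
        simp [← huv] at hp' hp
        exact absurd hp' hp
      simp [h u v hu0 hv0 hu hv]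
    · simp [huv]

lemma IsRelPrimitive.antipodeCoeff_mul {q : ι → kˣ} {d : ι → ℤ} {P : List ι → Prop}
    {R : List ι →₀ k} (h : IsRelPrimitive q d P R) (hrev : ∀ w, P w → P w.reverse)
    (happ : ∀ u v, P (u ++ v) → P u ∧ P v) (hR : R [] = 0) {w : List ι} (hP : P w)
    (hw : R w ≠ 0) : antipodeCoeff q d w 0 * antipodeCoeff q d w.reverse 0 = 1 := by
  have hne : w ≠ [] := by rintro rfl; exact hw hR
  have h1 := h.apply_add hrev happ hR hne hP
  have h2 := h.apply_add hrev happ hR (w := w.reverse) (by simpa) (hrev _ hP)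
  rw [List.reverse_reverse] at h2
  apply Units.ext
  push_cast
  have : R w * ((antipodeCoeff q d w 0 : k) * antipodeCoeff q d w.reverse 0) = R w * 1 := by
    linear_combination (antipodeCoeff q d w.reverse 0 : k) * h2 - h1
  exact mul_left_cancel₀ hw this

lemma antipodeCoeff_eq (q : ι → kˣ) (d : ι → ℤ) (u : List ι) (m : ℤ) :
    antipodeCoeff q d u m = antipodeCoeff q d u 0 * ((u.map q).prod ^ m)⁻¹ := by
  induction u generalizing m with
  | nil => simp [antipodeCoeff]
  | cons i u ih =>
    rw [antipodeCoeff, antipodeCoeff, ih (m + d i), ih (0 + d i)]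
    simp [mul_zpow, zpow_add]
    simp [mul_comm, mul_assoc]

/-- Peels the last letter instead of the first, as induction on reversed words requires. -/
lemma antipodeCoeff_append_singleton (q : ι → kˣ) (d : ι → ℤ) (u : List ι) (i : ι) (m : ℤ) :
    antipodeCoeff q d (u ++ [i]) m =
      antipodeCoeff q d u m * -(q i ^ (m + wordWeight d u))⁻¹ := by
  induction u generalizing m with
  | nil => simp [antipodeCoeff]
  | cons j u ih => simp [antipodeCoeff, ih, add_assoc, mul_assoc]

/-- The scalar by which the square of the antipode differs from conjugation by the weight. -/
lemma antipodeCoeff_mul_reverse (q : ι → kˣ) (d : ι → ℤ) (w : List ι) :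
    antipodeCoeff q d w 0 * antipodeCoeff q d w.reverse 0 =
      ((w.map q).prod ^ wordWeight d w)⁻¹ * (w.map fun i => q i ^ d i).prod := by
  induction w with
  | nil => simp [antipodeCoeff]
  | cons i w ih =>
    rw [List.reverse_cons, antipodeCoeff_append_singleton, antipodeCoeff, antipodeCoeff_eq]
    have : ∀ a b c e f : kˣ, -a * (b * c) * (e * -f) = a * c * f * (b * e) := by
      intro a b c e f; simp [mul_comm, mul_left_comm]
    rw [this, ih]
    simp [mul_zpow, zpow_add]
    simp [mul_comm, mul_left_comm, mul_assoc]

/-- The coefficient of `i ⊗ iⁿ` in the formal coproduct of `iⁿ⁺¹` is a quantum integer. -/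
lemma wordComul_replicate_singleton (q : ι → kˣ) (d : ι → ℤ) (i : ι) (n : ℕ) :
    wordComul q d (List.replicate (n + 1) i) ([i], List.replicate n i) =
      ∑ j ∈ Finset.range (n + 1), ((q i ^ d i : kˣ) : k) ^ j := by
  classical
  have hwt : ∀ n, wordWeight d (List.replicate n i) = n * d i := by simp [wordWeight]
  induction n with
  | zero => simp [wordComul, consComul]
  | succ n ih =>
    rw [List.replicate_succ, wordComul, consComul_apply_cons_left, Finset.sum_range_succ, ← ih]
    simp [wordComul_nil_left, List.replicate_succ (n := n), hwt]
    rw [← zpow_natCast, ← zpow_mul, add_comm]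
    simp [mul_comm]
    ring_nf

end WordCombinatorics

lemma LinearIndependent.exists_dual_single {k V κ : Type*} [Field k] [AddCommGroup V] [Module k V]
    [DecidableEq κ] {v : κ → V} (hv : LinearIndependent k v) (i : κ) :
    ∃ f : V →ₗ[k] k, ∀ j, f (v j) = if j = i then 1 else 0 := by
  obtain ⟨g, hg⟩ := LinearMap.exists_extend (Finsupp.lapply i ∘ₗ (hv.repr : _ →ₗ[k] κ →₀ k))
  refine ⟨g, fun j => ?_⟩
  have := LinearMap.congr_fun hg ⟨v j, Submodule.subset_span ⟨j, rfl⟩⟩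
  simp only [LinearMap.comp_apply, Submodule.subtype_apply, Finsupp.lapply_apply] at this
  rw [this, hv.repr_eq_single j _ rfl, Finsupp.single_apply]

/-! ### Independence of words in the Hopf algebra -/

section HopfWords

variable {k H ι : Type*} [Field k] [Ring H] [HopfAlgebra k H]

/-- The convolution-type bilinear evaluation `(f ⊗ g) ∘ Δ`. -/
noncomputable def comulEval (f g : H →ₗ[k] k) : H →ₗ[k] k :=
  LinearMap.mul' k k ∘ₗ TensorProduct.map f g ∘ₗ Coalgebra.comul

lemma mul_mem_groupLikeSpan (g : GroupLike k H) {z : H} (hz : z ∈ groupLikeSpan k H) :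
    g.val * z ∈ groupLikeSpan k H := by
  rw [groupLikeSpan] at hz ⊢
  induction hz using Submodule.span_induction with
  | mem z hz => exact Submodule.subset_span (g.isGroupLikeElem_val.mul hz)
  | zero => simp
  | add a b _ _ ha hb => rw [mul_add]; exact add_mem ha hb
  | smul c a _ ha => rw [mul_smul_comm]; exact Submodule.smul_mem _ _ ha

lemma mem_groupLikeSpan_mul (g : GroupLike k H) {z : H} (hz : z ∈ groupLikeSpan k H) :
    z * g.val ∈ groupLikeSpan k H := by
  rw [groupLikeSpan] at hz ⊢
  induction hz using Submodule.span_induction with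
  | mem z hz => exact Submodule.subset_span (IsGroupLikeElem.mul hz g.isGroupLikeElem_val)
  | zero => simp
  | add a b _ _ ha hb => rw [add_mul]; exact add_mem ha hb
  | smul c a _ ha => rw [smul_mul_assoc]; exact Submodule.smul_mem _ _ ha

lemma val_mem_groupLikeSpan (g : GroupLike k H) : g.val ∈ groupLikeSpan k H :=
  Submodule.subset_span g.isGroupLikeElem_val

/-- The coproduct maps $C_0$ into $C_0\otimes C_0$, so killing $C_0$ on one side suffices. -/
lemma comulEval_eq_zero_of_mem_groupLikeSpan {f g : H →ₗ[k] k}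
    (hf : ∀ z ∈ groupLikeSpan k H, f z = 0) {z : H} (hz : z ∈ groupLikeSpan k H) :
    comulEval f g z = 0 := by
  rw [groupLikeSpan] at hz
  induction hz using Submodule.span_induction with
  | mem z hz =>
    simp [comulEval, IsGroupLikeElem.comul_eq_tmul_self hz, hf z (Submodule.subset_span hz)]
  | zero => simp
  | add a b _ _ ha hb => simp [ha, hb]
  | smul c a _ ha => simp [ha]

lemma mul_zpow_val_comm {x : GroupLike k H} {y : H} {q : kˣ}
    (h : y * x.val = (q : k) • (x.val * y)) (a : ℤ) :
    y * (x ^ a).val = ((q ^ a : kˣ) : k) • ((x ^ a).val * y) := by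
  have hinv : y * (x⁻¹).val = ((q⁻¹ : kˣ) : k) • ((x⁻¹).val * y) := by
    have h1 : x.val * (x⁻¹).val = 1 := by rw [← GroupLike.val_mul]; simp
    have h2 : (x⁻¹).val * x.val = 1 := by rw [← GroupLike.val_mul]; simp
    have h3 : (x⁻¹).val * (y * x.val) * (x⁻¹).val = (q : k) • (y * (x⁻¹).val) := by
      rw [h, mul_smul_comm, smul_mul_assoc, ← mul_assoc, h2, one_mul]
    rw [← mul_assoc, mul_assoc, h1, mul_one] at h3
    rw [h3, smul_smul]
    simp
  induction a using Int.induction_on with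
  | zero => simp
  | succ n ih =>
    rw [zpow_add_one, zpow_add_one, GroupLike.val_mul, ← mul_assoc, ih, smul_mul_assoc, mul_assoc,
      h, mul_smul_comm, smul_smul, mul_assoc, Units.val_mul]
  | pred n ih =>
    rw [zpow_sub_one, zpow_sub_one, GroupLike.val_mul, ← mul_assoc, ih, smul_mul_assoc, mul_assoc,
      hinv, mul_smul_comm, smul_smul, mul_assoc, Units.val_mul]

/-- The product of a power of `x` and a word in the elements `y i`. -/
noncomputable def powWord (x : GroupLike k H) (y : ι → H) (p : ℤ × List ι) : H :=
  (x ^ p.1).val * (p.2.map y).prod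

/-- The span of the group-like elements and the products `powWord x y (a, w)` with `w` of length
less than `n`. -/
noncomputable def wordFiltration (x : GroupLike k H) (y : ι → H) (n : ℕ) : Submodule k H :=
  groupLikeSpan k H ⊔ Submodule.span k (powWord x y '' {p | p.2.length < n})

lemma powWord_mem_wordFiltration (x : GroupLike k H) (y : ι → H) {n : ℕ} {p : ℤ × List ι}
    (hp : p.2.length < n) : powWord x y p ∈ wordFiltration x y n :=
  Submodule.mem_sup_right (Submodule.subset_span ⟨p, hp, rfl⟩)

lemma zpow_mul_powWord (x : GroupLike k H) (y : ι → H) (a : ℤ) (p : ℤ × List ι) :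
    (x ^ a).val * powWord x y p = powWord x y (a + p.1, p.2) := by
  simp only [powWord]
  rw [← mul_assoc, ← GroupLike.val_mul, ← zpow_add]

lemma zpow_mul_mem_wordFiltration (x : GroupLike k H) (y : ι → H) {n : ℕ} (a : ℤ) {z : H}
    (hz : z ∈ wordFiltration x y n) : (x ^ a).val * z ∈ wordFiltration x y n := by
  have h : wordFiltration x y n ≤
      (wordFiltration x y n).comap (LinearMap.mulLeft k (x ^ a).val) := by
    refine sup_le (fun z hz => Submodule.mem_sup_left (mul_mem_groupLikeSpan _ hz))
      (Submodule.span_le.2 ?_)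
    rintro _ ⟨p, hp, rfl⟩
    simpa [zpow_mul_powWord] using
      powWord_mem_wordFiltration x y (p := (a + p.1, p.2)) hp
  exact h hz

variable {x : GroupLike k H} {y : ι → H} {q : ι → kˣ} {d : ι → ℤ}

/-- The twist in `consComul` is the cost of moving `y i` to the right past the power of $x$ already
collected. -/
lemma comul_word (hcomm : ∀ i, y i * x.val = (q i : k) • (x.val * y i))
    (hcomul : ∀ i, Coalgebra.comul (R := k) (y i) = y i ⊗ₜ[k] 1 + (x ^ d i).val ⊗ₜ[k] y i)
    (w : List ι) :
    Coalgebra.comul (R := k) (w.map y).prod = Finsupp.linearCombination k (fun p =>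
      powWord x y (wordWeight d p.2, p.1) ⊗ₜ[k] (p.2.map y).prod) (wordComul q d w) := by
  induction w with
  | nil => simp [wordComul, powWord, Algebra.TensorProduct.one_def]
  | cons i w ih =>
    rw [List.map_cons, List.prod_cons, Bialgebra.comul_mul, ih, hcomul, wordComul]
    generalize wordComul q d w = z
    induction z using Finsupp.induction_linear with
    | zero => simp
    | add f g hf hg => rw [map_add, map_add, mul_add, hf, hg, map_add]
    | single p c =>
      simp only [consComul, Finsupp.linearCombination_single, map_smul, map_add, add_mul,
        mul_smul_comm, Algebra.TensorProduct.tmul_mul_tmul, one_mul, one_smul, List.map_cons,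
        List.prod_cons, wordWeight_cons, zpow_mul_powWord]
      congr 2
      simp only [powWord, List.map_cons, List.prod_cons, TensorProduct.smul_tmul']
      rw [← mul_assoc, mul_zpow_val_comm (hcomm i), smul_mul_assoc, mul_assoc]

lemma comul_powWord (hcomm : ∀ i, y i * x.val = (q i : k) • (x.val * y i))
    (hcomul : ∀ i, Coalgebra.comul (R := k) (y i) = y i ⊗ₜ[k] 1 + (x ^ d i).val ⊗ₜ[k] y i)
    (a : ℤ) (w : List ι) :
    Coalgebra.comul (R := k) (powWord x y (a, w)) = Finsupp.linearCombination k (fun p =>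
      powWord x y (a + wordWeight d p.2, p.1) ⊗ₜ[k] powWord x y (a, p.2)) (wordComul q d w) := by
  rw [powWord, Bialgebra.comul_mul, comul_word hcomm hcomul,
    (x ^ a).isGroupLikeElem_val.comul_eq_tmul_self]
  generalize wordComul q d w = z
  induction z using Finsupp.induction_linear with
  | zero => simp
  | add f g hf hg => rw [map_add, mul_add, hf, hg, map_add]
  | single p c =>
    simp [Algebra.TensorProduct.tmul_mul_tmul, zpow_mul_powWord]
    rfl

/-- The elements `powWord x y (a, w)` with `w` of length `n` satisfying `P` are linearly independent
modulo `wordFiltration x y n`. -/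
def IndepInDegree (x : GroupLike k H) (y : ι → H) (P : List ι → Prop) (n : ℕ) : Prop :=
  ∀ c : ℤ × List ι →₀ k, (∀ p, c p ≠ 0 → P p.2 ∧ p.2.length = n) →
    Finsupp.linearCombination k (powWord x y) c ∈ wordFiltration x y n → c = 0

/-- Words outside `P` reduce to the filtration, where the functional vanishes; hence the dual-basis
formula holds for every word of length `n`, not just those in `P`. -/
lemma IndepInDegree.exists_dual [DecidableEq ι] {P : List ι → Prop} {n : ℕ}
    (h : IndepInDegree x y P n)
    (hred : ∀ w, ¬ P w → (w.map y).prod ∈ wordFiltration x y w.length)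
    {p₀ : ℤ × List ι} (hp₀ : P p₀.2) (hn : p₀.2.length = n) :
    ∃ f : H →ₗ[k] k, (∀ z ∈ wordFiltration x y n, f z = 0) ∧
      ∀ p : ℤ × List ι, p.2.length = n → f (powWord x y p) = if p = p₀ then 1 else 0 := by
  have hli : LinearIndependent k (fun p : {p : ℤ × List ι // P p.2 ∧ p.2.length = n} =>
      (wordFiltration x y n).mkQ (powWord x y p)) := by
    rw [linearIndependent_iff]
    intro l hl
    have h1 := h (l.embDomain (Function.Embedding.subtype _)) (by
      intro p hp
      rw [← Finsupp.mem_support_iff, Finsupp.support_embDomain, Finset.mem_map] at hp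
      obtain ⟨p', -, rfl⟩ := hp
      exact p'.2) (by
      rw [Finsupp.linearCombination_embDomain, ← Submodule.ker_mkQ (wordFiltration x y n),
        LinearMap.mem_ker, Finsupp.apply_linearCombination]
      exact hl)
    exact Finsupp.embDomain_eq_zero.1 h1
  obtain ⟨f, hf⟩ := hli.exists_dual_single ⟨p₀, hp₀, hn⟩
  refine ⟨f ∘ₗ (wordFiltration x y n).mkQ, fun z hz => ?_, fun p hp => ?_⟩
  · rw [LinearMap.comp_apply, Submodule.mkQ_apply, (Submodule.Quotient.mk_eq_zero _).2 hz, map_zero]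
  · by_cases hP : P p.2
    · simpa using hf ⟨p, hP, hp⟩
    · rw [LinearMap.comp_apply, Submodule.mkQ_apply, (Submodule.Quotient.mk_eq_zero _).2,
        map_zero, if_neg]
      · rintro rfl
        exact hP hp₀
      · exact hp ▸ zpow_mul_mem_wordFiltration x y p.1 (hred _ hP)

/-- Lengths add up under the coproduct, so any other term has a factor that is too short, killed by
the filtration, or has the right lengths but the wrong words. -/
lemma comulEval_powWord [DecidableEq ι]
    (hcomm : ∀ i, y i * x.val = (q i : k) • (x.val * y i))
    (hcomul : ∀ i, Coalgebra.comul (R := k) (y i) = y i ⊗ₜ[k] 1 + (x ^ d i).val ⊗ₜ[k] y i)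
    {f g : H →ₗ[k] k} {u v : List ι} {a : ℤ}
    (hf : ∀ z ∈ wordFiltration x y u.length, f z = 0)
    (hf' : ∀ p : ℤ × List ι, p.2.length = u.length →
      f (powWord x y p) = if p = (a + wordWeight d v, u) then 1 else 0)
    (hg : ∀ z ∈ wordFiltration x y v.length, g z = 0)
    (hg' : ∀ p : ℤ × List ι, p.2.length = v.length →
      g (powWord x y p) = if p = (a, v) then 1 else 0)
    {b : ℤ} {w : List ι} (hw : w.length ≤ u.length + v.length) :
    comulEval f g (powWord x y (b, w)) = if b = a then wordComul q d w (u, v) else 0 := by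
  rw [comulEval, LinearMap.comp_apply, LinearMap.comp_apply, comul_powWord hcomm hcomul,
    Finsupp.apply_linearCombination, Finsupp.apply_linearCombination,
    Finsupp.linearCombination_apply, Finsupp.sum, Finset.sum_eq_single (u, v)]
  · simp only [Function.comp_apply, TensorProduct.map_tmul, LinearMap.mul'_apply]
    rw [hf' _ rfl, hg' _ rfl]
    by_cases hb : b = a <;> simp [hb]
  · rintro ⟨u', v'⟩ hp hne
    have hlen := length_add_length_of_wordComul_ne_zero q d (Finsupp.mem_support_iff.1 hp)
    simp only [Function.comp_apply, TensorProduct.map_tmul, LinearMap.mul'_apply]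
    rcases lt_trichotomy u'.length u.length with h | h | h
    · rw [hf _ (powWord_mem_wordFiltration x y h)]; simp
    · rcases (show v'.length ≤ v.length by omega).lt_or_eq with h' | h'
      · rw [hg _ (powWord_mem_wordFiltration x y h')]; simp
      · rw [hf' _ h, hg' _ h']
        by_cases hu : u' = u
        · have hv : v' ≠ v := by rintro rfl; exact hne (by rw [hu])
          simp [hv]
        · simp [hu]
    · rw [hg _ (powWord_mem_wordFiltration x y (show v'.length < v.length by omega))]; simp
  · intro h
    rw [Finsupp.notMem_support_iff.1 h, zero_smul]

lemma formalComul_curry (q : ι → kˣ) (d : ι → ℤ) (c : ℤ × List ι →₀ k) (a : ℤ)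
    (p : List ι × List ι) :
    c.sum (fun r s => s * if r.1 = a then wordComul q d r.2 p else 0) =
      formalComul q d (c.curry a) p := by
  induction c using Finsupp.induction_linear with
  | zero =>
    have : (0 : ℤ × List ι →₀ k).curry a = 0 := by ext; simp [Finsupp.curry_apply]
    simp [this]
  | add f g hf hg =>
    rw [Finsupp.sum_add_index' (by simp) (by intros; ring), hf, hg]
    have : (f + g).curry a = f.curry a + g.curry a := by ext; simp [Finsupp.curry_apply]
    rw [this, map_add, Finsupp.add_apply]
  | single r s =>
    rw [Finsupp.sum_single_index (by simp), Finsupp.curry_single]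
    by_cases h : r.1 = a
    · simp [h, formalComul]
    · simp [h]

/-- Pairing the coproduct of a relation with dual functionals in degrees `u.length` and `v.length`
extracts one mixed coefficient for one power of $x$. The lower filtration contributes nothing, so
each slice `c.curry a` is relatively primitive. -/
lemma IndepInDegree.step (hcomm : ∀ i, y i * x.val = (q i : k) • (x.val * y i))
    (hcomul : ∀ i, Coalgebra.comul (R := k) (y i) = y i ⊗ₜ[k] 1 + (x ^ d i).val ⊗ₜ[k] y i)
    {P : List ι → Prop} (hred : ∀ w, ¬ P w → (w.map y).prod ∈ wordFiltration x y w.length)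
    {n : ℕ} (hind : ∀ m, 0 < m → m < n → IndepInDegree x y P m)
    (hprim : ∀ R : List ι →₀ k, (∀ w, R w ≠ 0 → P w ∧ w.length = n) →
      IsRelPrimitive q d P R → R = 0) : IndepInDegree x y P n := by
  classical
  intro c hc hmem
  suffices h : ∀ a, c.curry a = 0 by
    ext ⟨a, w⟩
    simpa [Finsupp.curry_apply] using DFunLike.congr_fun (h a) w
  intro a
  have hsupp : ∀ w, c.curry a w ≠ 0 → P w ∧ w.length = n := fun w hw =>
    hc (a, w) (by simpa [Finsupp.curry_apply] using hw)
  refine hprim _ hsupp fun u v hu hv hPu hPv => ?_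
  by_cases hlen : u.length + v.length = n
  · have hu' := List.length_pos_of_ne_nil hu
    have hv' := List.length_pos_of_ne_nil hv
    obtain ⟨f, hf, hf'⟩ := (hind u.length hu' (by omega)).exists_dual hred
      (p₀ := (a + wordWeight d v, u)) hPu rfl
    obtain ⟨g, hg, hg'⟩ := (hind v.length hv' (by omega)).exists_dual hred
      (p₀ := (a, v)) hPv rfl
    have key : ∀ b w, w.length ≤ n → comulEval f g (powWord x y (b, w)) =
        if b = a then wordComul q d w (u, v) else 0 := fun b w hw =>
      comulEval_powWord hcomm hcomul hf hf' hg hg' (by omega)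
    have hvanish : ∀ z ∈ wordFiltration x y n, comulEval f g z = 0 := by
      intro z hz
      obtain ⟨s, hs, t, ht, rfl⟩ := Submodule.mem_sup.1 hz
      rw [map_add, comulEval_eq_zero_of_mem_groupLikeSpan
        (fun z hz => hf z (Submodule.mem_sup_left hz)) hs, zero_add]
      refine (Submodule.span_le (p := LinearMap.ker (comulEval f g))).2 ?_ ht
      rintro _ ⟨⟨b, w⟩, hw, rfl⟩
      have hw : w.length < n := hw
      have h0 : wordComul q d w (u, v) = 0 := by
        by_contra hne
        have := length_add_length_of_wordComul_ne_zero q d hne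
        omega
      simp [LinearMap.mem_ker, key b w hw.le, h0]
    rw [← formalComul_curry]
    refine Eq.trans ?_ (hvanish _ hmem)
    rw [Finsupp.linearCombination_apply, map_finsuppSum]
    refine Finsupp.sum_congr fun p hp => ?_
    rw [map_smul, key p.1 p.2 (hc p (Finsupp.mem_support_iff.1 hp)).2.le, smul_eq_mul]
  · rw [formalComul, Finsupp.linearCombination_apply, Finsupp.sum, Finsupp.finsetSum_apply]
    refine Finset.sum_eq_zero fun w hw => ?_
    have h0 : wordComul q d w (u, v) = 0 := by
      by_contra hne
      exact hlen ((length_add_length_of_wordComul_ne_zero q d hne).trans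
        (hsupp w (Finsupp.mem_support_iff.1 hw)).2)
    simp [h0]

lemma linearIndependent_zpow_val (hx : ¬ IsOfFinOrder x) :
    LinearIndependent k (fun a : ℤ => (x ^ a).val) :=
  linearIndep_groupLikeVal.comp _ (injective_zpow_iff_not_isOfFinOrder.2 hx)

lemma IndepInDegree.one (hx : ¬ IsOfFinOrder x)
    (hcomul : ∀ i, Coalgebra.comul (R := k) (y i) = y i ⊗ₜ[k] 1 + (x ^ d i).val ⊗ₜ[k] y i)
    (hind : LinearIndependent k fun i => (groupLikeSpan k H).mkQ (y i)) (P : List ι → Prop) :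
    IndepInDegree x y P 1 := by
  classical
  intro c hc hmem
  ext ⟨a, w⟩
  rw [Finsupp.zero_apply]
  by_contra hne
  obtain ⟨i, rfl⟩ := List.length_eq_one_iff.1 (hc _ hne).2
  obtain ⟨f, hf⟩ := hind.exists_dual_single i
  obtain ⟨g, hg⟩ := (linearIndependent_zpow_val hx).exists_dual_single a
  -- The shift by $x^{-a}$ makes `f'` detect $y_i$ inside $x^a y_i$. Its values for other powers of
  -- $x$ do not matter, since `g` kills those terms.
  set f' : H →ₗ[k] k :=
    f ∘ₗ (groupLikeSpan k H).mkQ ∘ₗ LinearMap.mulLeft k (x ^ (-a)).val with hf'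
  have hf0 : ∀ z ∈ groupLikeSpan k H, f' z = 0 := fun z hz => by
    rw [hf', LinearMap.comp_apply, LinearMap.comp_apply, LinearMap.mulLeft_apply,
      Submodule.mkQ_apply, (Submodule.Quotient.mk_eq_zero _).2 (mul_mem_groupLikeSpan _ hz),
      map_zero]
  have hfy : ∀ j, f' (powWord x y (a, [j])) = if j = i then 1 else 0 := fun j => by
    rw [hf', LinearMap.comp_apply, LinearMap.comp_apply, LinearMap.mulLeft_apply,
      zpow_mul_powWord, ← hf]
    simp [powWord]
  have hmem' : Finsupp.linearCombination k (powWord x y) c ∈ groupLikeSpan k H := by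
    have h : wordFiltration x y 1 ≤ groupLikeSpan k H := by
      refine sup_le le_rfl (Submodule.span_le.2 ?_)
      rintro _ ⟨⟨b, w⟩, hw, rfl⟩
      obtain rfl : w = [] := List.length_eq_zero_iff.1 (Nat.lt_one_iff.1 hw)
      simpa [powWord] using val_mem_groupLikeSpan (x ^ b)
    exact h hmem
  have h0 := comulEval_eq_zero_of_mem_groupLikeSpan (g := g) hf0 hmem'
  have key : ∀ b j, comulEval f' g (powWord x y (b, [j])) =
      if (b, [j]) = (a, [i]) then 1 else 0 := by
    intro b j
    have : Coalgebra.comul (R := k) (powWord x y (b, [j])) =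
        powWord x y (b, [j]) ⊗ₜ[k] (x ^ b).val +
          (x ^ (b + d j)).val ⊗ₜ[k] powWord x y (b, [j]) := by
      simp only [powWord, List.map_cons, List.map_nil, List.prod_cons, List.prod_nil, mul_one]
      rw [Bialgebra.comul_mul, hcomul, (x ^ b).isGroupLikeElem_val.comul_eq_tmul_self, mul_add,
        Algebra.TensorProduct.tmul_mul_tmul, Algebra.TensorProduct.tmul_mul_tmul, mul_one,
        ← GroupLike.val_mul, ← zpow_add]
    rw [comulEval, LinearMap.comp_apply, LinearMap.comp_apply, this]
    simp only [map_add, TensorProduct.map_tmul, LinearMap.mul'_apply, hg,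
      hf0 _ (val_mem_groupLikeSpan _), zero_mul, add_zero]
    by_cases hb : b = a
    · subst hb; simp [hfy]
    · simp [hb]
  rw [Finsupp.linearCombination_apply, map_finsuppSum, Finsupp.sum,
    Finset.sum_eq_single (a, [i])] at h0
  · rw [map_smul, key] at h0
    exact hne (by simpa using h0)
  · rintro ⟨b, w⟩ hp hpne
    obtain ⟨j, rfl⟩ := List.length_eq_one_iff.1 (hc _ (Finsupp.mem_support_iff.1 hp)).2
    rw [map_smul, key, if_neg hpne, smul_zero]
  · intro h
    rw [Finsupp.notMem_support_iff.1 h, zero_smul, map_zero]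

/-- Words satisfying `P` in skew primitive elements are linearly independent, provided that there
is no formal primitive element relative to `P` of degree at least two. -/
theorem linearIndependent_words (hx : ¬ IsOfFinOrder x)
    (hcomm : ∀ i, y i * x.val = (q i : k) • (x.val * y i))
    (hcomul : ∀ i, Coalgebra.comul (R := k) (y i) = y i ⊗ₜ[k] 1 + (x ^ d i).val ⊗ₜ[k] y i)
    (hind : LinearIndependent k fun i => (groupLikeSpan k H).mkQ (y i))
    {P : List ι → Prop} (hred : ∀ w, ¬ P w → (w.map y).prod ∈ wordFiltration x y w.length)
    (hprim : ∀ n, 2 ≤ n → ∀ R : List ι →₀ k, (∀ w, R w ≠ 0 → P w ∧ w.length = n) →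
      IsRelPrimitive q d P R → R = 0) :
    LinearIndependent k fun w : {w // P w} => (w.1.map y).prod := by
  classical
  have hdeg : ∀ n, 0 < n → IndepInDegree x y P n := by
    intro n
    induction n using Nat.strong_induction_on with
    | _ n ih =>
      intro hn
      rcases Nat.eq_or_lt_of_le hn with rfl | hn'
      · exact IndepInDegree.one hx hcomul hind P
      · exact IndepInDegree.step hcomm hcomul hred (fun m h0 hm => ih m hm h0) (hprim n hn')
  -- In an inhomogeneous relation the top-degree part lies in the lower filtration, hence is zero;
  -- the bound on lengths then drops.
  have main : ∀ n, ∀ R : List ι →₀ k, (∀ w, R w ≠ 0 → P w ∧ w.length < n) →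
      Finsupp.linearCombination k (fun w : List ι => (w.map y).prod) R = 0 → R = 0 := by
    intro n
    induction n with
    | zero =>
      intro R hR _
      ext w
      by_contra hne
      exact absurd (hR w hne).2 (Nat.not_lt_zero _)
    | succ n ih =>
      intro R hR h0
      -- The empty word lies in $C_0$, so it is handled separately, using only $1\neq0$.
      rcases Nat.eq_zero_or_pos n with rfl | hn
      · have hR1 : R = Finsupp.single [] (R []) := by
          ext w
          by_cases hw : w = []
          · simp [hw]
          · rw [Finsupp.single_eq_of_ne hw]
            by_contra hne
            exact hw (List.length_eq_zero_iff.1 (by have := (hR w hne).2; omega))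
        rw [hR1, Finsupp.linearCombination_single] at h0
        have h1 : (1 : H) ≠ 0 := (IsGroupLikeElem.one (R := k)).ne_zero
        have : R [] = 0 := by simpa [h1] using h0
        rw [hR1, this, Finsupp.single_zero]
      · have hsplit := Finsupp.filter_add_filter_not R (fun w => w.length = n)
        have htop : R.filter (fun w => w.length = n) = 0 := by
          have hinj : Function.Injective (fun w : List ι => ((0 : ℤ), w)) := fun _ _ h => by
            simpa using h
          have := hdeg n hn ((R.filter (fun w => w.length = n)).embDomain ⟨_, hinj⟩) (by
            intro p hp
            rw [← Finsupp.mem_support_iff, Finsupp.support_embDomain, Finset.mem_map] at hp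
            obtain ⟨w, hw, rfl⟩ := hp
            rw [Finsupp.mem_support_iff, Finsupp.filter_apply] at hw
            split_ifs at hw with hl
            · exact ⟨(hR w hw).1, hl⟩
            · exact absurd rfl hw) (by
            rw [Finsupp.linearCombination_embDomain]
            have he : (powWord x y ∘ (⟨_, hinj⟩ : List ι ↪ ℤ × List ι)) =
                fun w : List ι => (w.map y).prod := by
              funext w; simp [powWord]
            rw [he]
            rw [← hsplit, map_add] at h0
            rw [eq_neg_of_add_eq_zero_left h0]
            refine neg_mem (Submodule.sum_mem _ fun w hw => Submodule.smul_mem _ _ ?_)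
            rw [Finsupp.mem_support_iff, Finsupp.filter_apply] at hw
            by_cases hl : w.length = n
            · simp [hl] at hw
            · rw [if_pos hl] at hw
              have := powWord_mem_wordFiltration x y (n := n) (p := (0, w))
                (by have := (hR w hw).2; simp only; omega)
              simpa [powWord] using this)
          exact Finsupp.embDomain_eq_zero.1 this
        refine ih R (fun w hw => ⟨(hR w hw).1, ?_⟩) h0
        have h1 : w.length ≠ n := by
          intro hl
          have := DFunLike.congr_fun htop w
          rw [Finsupp.filter_apply, if_pos hl] at this
          exact hw this
        have := (hR w hw).2
        omega
  rw [linearIndependent_iff]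
  intro l hl
  have h1 : ∀ w, l.embDomain (Function.Embedding.subtype _) w ≠ 0 →
      P w ∧ w ∈ (l.embDomain (Function.Embedding.subtype _)).support := by
    intro w hw
    refine ⟨?_, Finsupp.mem_support_iff.2 hw⟩
    rw [← Finsupp.mem_support_iff, Finsupp.support_embDomain, Finset.mem_map] at hw
    obtain ⟨w, -, rfl⟩ := hw
    exact w.2
  refine Finsupp.embDomain_eq_zero.1 (main
    ((l.embDomain (Function.Embedding.subtype _)).support.sup List.length + 1) _
    (fun w hw => ⟨(h1 w hw).1, Nat.lt_succ_of_le (Finset.le_sup (f := List.length) (h1 w hw).2)⟩)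
    ?_)
  rw [Finsupp.linearCombination_embDomain]
  exact hl

end HopfWords

/-! ### Free subalgebras and exponential growth -/

section FreeAndGrowth

variable {k A ι : Type*} [Field k] [Ring A] [Algebra k A]

lemma injective_freeAlgebra_lift {f : ι → A}
    (h : LinearIndependent k fun w : List ι => (w.map f).prod) :
    Function.Injective (FreeAlgebra.lift k f) := by
  have hcomp : FreeAlgebra.lift k f =
      (MonoidAlgebra.lift k A (FreeMonoid ι) (FreeMonoid.lift f)).comp
        (FreeAlgebra.equivMonoidAlgebraFreeMonoid (R := k) (X := ι)).toAlgHom := by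
    ext i
    simp [FreeAlgebra.equivMonoidAlgebraFreeMonoid]
  rw [hcomp]
  refine Function.Injective.comp (g := MonoidAlgebra.lift k A (FreeMonoid ι) (FreeMonoid.lift f))
    ?_ (FreeAlgebra.equivMonoidAlgebraFreeMonoid (R := k) (X := ι)).injective
  rw [injective_iff_map_eq_zero]
  intro z hz
  rw [MonoidAlgebra.lift_apply] at hz
  simp only [FreeMonoid.lift_apply] at hz
  have := (linearIndependent_iff.1 h) z.coeff ((Finsupp.linearCombination_apply k _).trans hz)
  ext w
  exact DFunLike.congr_fun this w

lemma prod_mem_one_sup_pow {V : Submodule k A} {f : ι → A} (hf : ∀ i, f i ∈ V) (w : List ι) :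
    (w.map f).prod ∈ (1 ⊔ V) ^ w.length := by
  induction w with
  | nil => simpa [Submodule.mem_one] using ⟨1, map_one _⟩
  | cons i w ih =>
    rw [List.map_cons, List.prod_cons, List.length_cons, pow_succ']
    exact Submodule.mul_mem_mul (Submodule.mem_sup_right (hf i)) ih

/-- The $2^n$ words of length exactly $n$ are independent in $(k+V)^n$, so $c=2$ works. -/
lemma hasExponentialGrowth_of_linearIndependent {f : Fin 2 → A}
    (h : LinearIndependent k fun w : List (Fin 2) => (w.map f).prod) :
    HasExponentialGrowth k A := by
  refine ⟨Submodule.span k (Set.range f), FiniteDimensional.span_of_finite k (Set.finite_range f),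
    2, by norm_num, Filter.Eventually.of_forall fun n => ?_⟩
  set W : Submodule k A := (1 ⊔ Submodule.span k (Set.range f)) ^ n with hW
  have hfg : W.FG := by
    refine Submodule.FG.pow (Submodule.FG.sup ?_ (Submodule.fg_span (Set.finite_range f))) n
    rw [Submodule.one_eq_span]
    exact Submodule.fg_span_singleton 1
  have : Module.Finite k W := Module.Finite.of_fg hfg
  have hli : LinearIndependent k fun v : Fin n → Fin 2 =>
      (⟨((List.ofFn v).map f).prod, by
        simpa [hW] using prod_mem_one_sup_pow
          (fun i => Submodule.subset_span (R := k) (Set.mem_range_self (f := f) i))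
          (List.ofFn v)⟩ : W) := by
    refine LinearIndependent.of_comp W.subtype ?_
    exact h.comp List.ofFn List.ofFn_injective
  have := hli.fintype_card_le_finrank
  simp only [Fintype.card_fun, Fintype.card_fin] at this
  exact_mod_cast this

lemma hasFreeSubalgebra_and_growth {a b : A}
    (h : LinearIndependent k fun w : List (Fin 2) => (w.map ![a, b]).prod) :
    HasFreeSubalgebraRankTwo k A ∧ HasExponentialGrowth k A :=
  ⟨⟨a, b, injective_freeAlgebra_lift h⟩, hasExponentialGrowth_of_linearIndependent h⟩

end FreeAndGrowth

/-! ### The twist criterion and its arithmetic -/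

section Twist

variable {k ι : Type*} [Field k]

/-- The twist confines the support to the single word $i^n$; its coproduct has the quantum integer
$[n]$ at $i\otimes i^{n-1}$, which forces the coefficient to vanish. -/
lemma IsRelPrimitive.eq_zero {q : ι → kˣ} {d : ι → ℤ} {P : List ι → Prop}
    (hrev : ∀ w, P w → P w.reverse) (happ : ∀ u v, P (u ++ v) → P u ∧ P v) (i : ι) {n : ℕ}
    (hn : 2 ≤ n)
    (htwist : ∀ w, P w → w.length = n →
      antipodeCoeff q d w 0 * antipodeCoeff q d w.reverse 0 = 1 →
        w = List.replicate n i ∧ ∑ j ∈ Finset.range n, ((q i ^ d i : kˣ) : k) ^ j ≠ 0)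
    {R : List ι →₀ k} (hR : ∀ w, R w ≠ 0 → P w ∧ w.length = n) (h : IsRelPrimitive q d P R) :
    R = 0 := by
  have hR0 : R [] = 0 := by
    by_contra hne
    have := (hR _ hne).2
    simp at this
    omega
  have key : ∀ w, R w ≠ 0 →
      w = List.replicate n i ∧ ∑ j ∈ Finset.range n, ((q i ^ d i : kˣ) : k) ^ j ≠ 0 :=
    fun w hw => htwist w (hR w hw).1 (hR w hw).2
      (h.antipodeCoeff_mul hrev happ hR0 (hR w hw).1 hw)
  ext w
  rw [Finsupp.zero_apply]
  by_contra hw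
  obtain ⟨rfl, hne⟩ := key w hw
  have hP := (hR _ hw).1
  have hRs : R = Finsupp.single (List.replicate n i) (R (List.replicate n i)) := by
    classical
    ext w
    by_cases h0 : R w = 0
    · by_cases h1 : w = List.replicate n i
      · rw [h1, Finsupp.single_eq_same]
      · rw [h0, Finsupp.single_eq_of_ne h1]
    · rw [(key w h0).1, Finsupp.single_eq_same]
  obtain ⟨m, rfl⟩ : ∃ m, n = m + 1 := ⟨n - 1, by omega⟩
  have hsplit : List.replicate (m + 1) i = [i] ++ List.replicate m i := by
    simp [List.replicate_succ]
  have h0 := h [i] (List.replicate m i) (by simp) (by simp; omega)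
    (happ _ _ (hsplit ▸ hP)).1 (happ _ _ (hsplit ▸ hP)).2
  rw [hRs, formalComul, Finsupp.linearCombination_single, Finsupp.smul_apply,
    wordComul_replicate_singleton, smul_eq_mul] at h0
  exact (mul_ne_zero hw hne) h0

lemma antipodeCoeff_mul_reverse_fin_two (q : Fin 2 → kˣ) (d : Fin 2 → ℤ) (w : List (Fin 2)) :
    (antipodeCoeff q d w 0 * antipodeCoeff q d w.reverse 0)⁻¹ =
      q 0 ^ (d 0 * (w.count 0 * (w.count 0 - 1)) + d 1 * (w.count 0 * w.count 1)) *
        q 1 ^ (d 1 * (w.count 1 * (w.count 1 - 1)) + d 0 * (w.count 0 * w.count 1)) := by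
  have h1 : (w.map q).prod = q 0 ^ (w.count 0 : ℤ) * q 1 ^ (w.count 1 : ℤ) := by
    clear * -
    simp only [zpow_natCast]
    induction w with
    | nil => simp
    | cons i w ih => fin_cases i <;> simp [ih, pow_succ', mul_left_comm, mul_assoc]
  have h2 : (w.map fun i => q i ^ d i).prod =
      q 0 ^ (d 0 * w.count 0) * q 1 ^ (d 1 * w.count 1) := by
    clear * -
    simp only [zpow_mul, zpow_natCast]
    induction w with
    | nil => simp
    | cons i w ih => fin_cases i <;> simp [ih, pow_succ', mul_left_comm, mul_assoc]
  have h3 : wordWeight d w = d 0 * w.count 0 + d 1 * w.count 1 := by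
    clear * -
    induction w with
    | nil => simp
    | cons i w ih => fin_cases i <;> simp [ih] <;> ring
  rw [antipodeCoeff_mul_reverse, h1, h2, h3, mul_zpow, ← zpow_mul, ← zpow_mul]
  have : ∀ a b c e : kˣ, ((a * b)⁻¹ * (c * e))⁻¹ = (a * c⁻¹) * (b * e⁻¹) := by
    intro a b c e; simp [mul_comm, mul_left_comm, mul_assoc]
  rw [this, ← zpow_neg, ← zpow_neg, ← zpow_add, ← zpow_add]
  congr 2 <;> ring

lemma count_zero_add_count_one (w : List (Fin 2)) : w.count 0 + w.count 1 = w.length := by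
  induction w with
  | nil => simp
  | cons i w ih => fin_cases i <;> simp <;> omega

lemma IsUnityRoot.of_zpow_eq_one {q : kˣ} {a : ℤ} (ha : a ≠ 0) (h : q ^ a = 1) :
    IsUnityRoot q := by
  refine ⟨a.natAbs, Int.natAbs_pos.2 ha, ?_⟩
  rcases Int.natAbs_eq a with h' | h'
  · rwa [h', zpow_natCast] at h
  · rwa [h', zpow_neg, inv_eq_one, zpow_natCast] at h

/-- Two generators of a group isomorphic to $\mathbb Z^2$ form a basis, because a surjective
endomorphism of $\mathbb Z^2$ is injective. -/
lemma GeneratesFreeAbelianRankTwo.eq_zero {q₁ q₂ : kˣ} (h : GeneratesFreeAbelianRankTwo q₁ q₂)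
    {a b : ℤ} (hab : q₁ ^ a * q₂ ^ b = 1) : a = 0 ∧ b = 0 := by
  obtain ⟨hfree, hrank⟩ := h
  have : Module.Finite ℤ (Additive (Subgroup.closure {q₁, q₂} : Subgroup kˣ)) :=
    Module.finite_of_finrank_eq_succ hrank
  let e := (Module.finBasisOfFinrankEq ℤ _ hrank).equivFun
  let g₁ : Subgroup.closure {q₁, q₂} := ⟨q₁, Subgroup.subset_closure (by simp)⟩
  let g₂ : Subgroup.closure {q₁, q₂} := ⟨q₂, Subgroup.subset_closure (by simp)⟩
  let φ : (Fin 2 → ℤ) →ₗ[ℤ] Additive (Subgroup.closure {q₁, q₂} : Subgroup kˣ) :=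
    Fintype.linearCombination ℤ ![Additive.ofMul g₁, Additive.ofMul g₂]
  have hφ : ∀ v, φ v = Additive.ofMul (g₁ ^ v 0 * g₂ ^ v 1) := by
    intro v
    simp [φ, Fintype.linearCombination_apply, Fin.sum_univ_two]
  have hsurj : Function.Surjective φ := by
    intro z
    obtain ⟨m, n, hmn⟩ := Subgroup.mem_closure_pair.1 z.toMul.2
    refine ⟨![m, n], ?_⟩
    rw [hφ]
    exact Additive.toMul.injective (Subtype.ext (by simpa [g₁, g₂] using hmn))
  have hinj : Function.Injective (e.toLinearMap ∘ₗ φ) :=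
    OrzechProperty.injective_of_surjective_endomorphism _ (e.surjective.comp hsurj)
  have h0 : ![a, b] = 0 := by
    apply hinj
    have : φ ![a, b] = 0 := by
      rw [hφ]
      exact Additive.toMul.injective (Subtype.ext (by simpa [g₁, g₂] using hab))
    simp [this]
  exact ⟨congr_fun h0 0, congr_fun h0 1⟩

end Twist

/-! ### Vanishing of quantum binomials at roots of unity -/

section QuantumBinomial

variable {k : Type*} [Field k]

/-- Solutions of the `Q`-Pascal recursion satisfy the absorption identities. -/
lemma qBinomial_absorption {Q : k} {B : ℕ → ℕ → k} (h0 : ∀ b, B 0 b = 1) (h0' : ∀ a, B a 0 = 1)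
    (hB : ∀ a b, B (a + 1) (b + 1) = Q ^ (b + 1) * B a (b + 1) + B (a + 1) b) (a b : ℕ) :
    (∑ j ∈ Finset.range (a + 1), Q ^ j) * B (a + 1) b =
        (∑ j ∈ Finset.range (a + b + 1), Q ^ j) * B a b ∧
      (∑ j ∈ Finset.range (b + 1), Q ^ j) * B a (b + 1) =
        (∑ j ∈ Finset.range (a + b + 1), Q ^ j) * B a b := by
  have hadd : ∀ m n, ∑ j ∈ Finset.range (m + n), Q ^ j =
      ∑ j ∈ Finset.range m, Q ^ j + Q ^ m * ∑ j ∈ Finset.range n, Q ^ j := by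
    intro m n
    rw [Finset.sum_range_add, Finset.mul_sum]
    simp [pow_add]
  obtain ⟨s, hs⟩ : ∃ s, a + b = s := ⟨_, rfl⟩
  induction s generalizing a b with
  | zero =>
    obtain ⟨rfl, rfl⟩ : a = 0 ∧ b = 0 := by omega
    simp [h0, h0']
  | succ s ih =>
    constructor
    · cases b with
      | zero => simp [h0']
      | succ b =>
        obtain ⟨i1, i2⟩ := ih a b (by omega)
        rw [hB, show a + (b + 1) + 1 = (b + 1) + (a + 1) by ring, hadd (b + 1) (a + 1)]
        linear_combination i1 - i2
    · cases a with
      | zero => simp [h0]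
      | succ a =>
        obtain ⟨i1, i2⟩ := ih a b (by omega)
        rw [hB, show a + 1 + b + 1 = (b + 1) + (a + 1) by ring, hadd (b + 1) (a + 1)]
        linear_combination Q ^ (b + 1) * (i2 - i1)

variable {ι : Type*}

lemma eq_replicate_of_wordComul_replicate_ne_zero (q : ι → kˣ) (d : ι → ℤ) {i : ι} {n : ℕ}
    {u v : List ι} (h : wordComul q d (List.replicate n i) (u, v) ≠ 0) :
    u = List.replicate u.length i ∧ v = List.replicate v.length i := by
  classical
  induction n generalizing u v with
  | zero =>
    simp [wordComul, Finsupp.single_apply] at h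
    simp [h]
  | succ n ih =>
    cases u with
    | nil =>
      rw [wordComul_nil_left] at h
      have hv : List.replicate (n + 1) i = v := by by_contra h'; simp [h'] at h
      simp [← hv]
    | cons j u =>
      rw [List.replicate_succ, wordComul, consComul_apply_cons_left] at h
      by_cases h1 : (if i = j then ((q i ^ wordWeight d v : kˣ) : k) *
          wordComul q d (List.replicate n i) (u, v) else 0) = 0
      · rw [h1, zero_add] at h
        cases v with
        | nil => simp at h
        | cons l v =>
          simp only [ne_eq, ite_eq_right_iff, Classical.not_imp] at h
          obtain ⟨h2, h3⟩ := ih h.2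
          refine ⟨h2, ?_⟩
          rw [List.length_cons, List.replicate_succ, ← h3, h.1]
      · simp only [ite_eq_right_iff, mul_eq_zero, not_or, Classical.not_imp] at h1
        obtain ⟨h2, h3⟩ := ih h1.2.2
        refine ⟨?_, h3⟩
        rw [List.length_cons, List.replicate_succ, ← h2, h1.1]

/-- The coefficients are Gaussian binomials. Absorption gives
$[a]\binom{n}{a}=[n]\binom{n-1}{a-1}=0$, while $[a]\ne0$ for $0<a<n$. -/
lemma wordComul_replicate_eq (q : ι → kˣ) (d : ι → ℤ) (i : ι) {n : ℕ}
    (hn : ∑ j ∈ Finset.range n, ((q i ^ d i : kˣ) : k) ^ j = 0) (hpos : 0 < n)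
    (hlt : ∀ m, 0 < m → m < n → ∑ j ∈ Finset.range m, ((q i ^ d i : kˣ) : k) ^ j ≠ 0) :
    wordComul q d (List.replicate n i) =
      Finsupp.single (List.replicate n i, []) 1 + Finsupp.single ([], List.replicate n i) 1 := by
  classical
  let B : ℕ → ℕ → k := fun a b =>
    wordComul q d (List.replicate (a + b) i) (List.replicate a i, List.replicate b i)
  have hB0 : ∀ b, B 0 b = 1 := fun b => by simp [B, wordComul_nil_left]
  have hB0' : ∀ a, B a 0 = 1 := fun a => by simp [B, wordComul_nil_right]
  have hB : ∀ a b, B (a + 1) (b + 1) =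
      ((q i ^ d i : kˣ) : k) ^ (b + 1) * B a (b + 1) + B (a + 1) b := by
    intro a b
    simp only [B]
    rw [show a + 1 + (b + 1) = (a + 1 + b) + 1 by ring, List.replicate_succ, wordComul,
      List.replicate_succ (n := a), consComul_apply_cons_left, List.replicate_succ (n := b)]
    have hwt : wordWeight d (i :: List.replicate b i) = d i * ((b + 1 : ℕ) : ℤ) := by
      simp [wordWeight]; ring
    simp only [if_true]
    rw [hwt, zpow_mul, zpow_natCast, show a + (b + 1) = a + 1 + b by ring]
    push_cast
    rfl
  ext ⟨u, v⟩
  rw [Finsupp.add_apply]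
  by_cases hu : u = []
  · subst hu
    rw [wordComul_nil_left]
    have h1 : List.replicate n i ≠ [] := by simp; omega
    simp [Finsupp.single_apply, h1]
  by_cases hv : v = []
  · subst hv
    rw [wordComul_nil_right]
    have h1 : List.replicate n i ≠ [] := by simp; omega
    simp [Finsupp.single_apply, h1]
  have hR : (Finsupp.single (List.replicate n i, ([] : List ι)) (1 : k)) (u, v) +
      (Finsupp.single (([] : List ι), List.replicate n i) (1 : k)) (u, v) = 0 := by
    simp [Ne.symm hu, Ne.symm hv]
  rw [hR]
  by_contra hne
  have hlen := length_add_length_of_wordComul_ne_zero q d hne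
  obtain ⟨h1, h2⟩ := eq_replicate_of_wordComul_replicate_ne_zero q d hne
  have hu' := List.length_pos_of_ne_nil hu
  have hv' := List.length_pos_of_ne_nil hv
  rw [List.length_replicate] at hlen
  obtain ⟨a, ha⟩ : ∃ a, u.length = a + 1 := ⟨u.length - 1, by omega⟩
  have hz := (qBinomial_absorption hB0 hB0' hB a v.length).1
  rw [show a + v.length + 1 = n by omega, hn, zero_mul, ← ha] at hz
  refine (mul_ne_zero (hlt u.length hu' (by omega)) ?_) hz
  simp only [B]
  rwa [hlen, ← h1, ← h2]

lemma geom_sum_orderOf_eq_zero {Q : k} (h1 : Q ≠ 1) :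
    ∑ j ∈ Finset.range (orderOf Q), Q ^ j = 0 := by
  have := geom_sum_mul Q (orderOf Q)
  rw [pow_orderOf_eq_one, sub_self] at this
  exact (mul_eq_zero.1 this).resolve_right (sub_ne_zero.2 h1)

lemma geom_sum_ne_zero_of_lt_orderOf {Q : k} {m : ℕ} (hm : 0 < m) (hlt : m < orderOf Q) :
    ∑ j ∈ Finset.range m, Q ^ j ≠ 0 := by
  intro h
  have := geom_sum_mul Q m
  rw [h, zero_mul, eq_comm, sub_eq_zero] at this
  exact pow_ne_one_of_lt_orderOf hm.ne' hlt this

end QuantumBinomial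

/-! ### Pairs of skew primitive elements: the generic and root of unity cases -/

section SkewPrimitivePairs

variable {k H : Type*} [Field k] [Ring H] [HopfAlgebra k H]

lemma not_isOfFinOrder_of_not_isUnityRoot {x : GroupLike k H} {y : H} {q : kˣ} (hy : y ≠ 0)
    (h : y * x.val = (q : k) • (x.val * y)) (hq : ¬ IsUnityRoot q) : ¬ IsOfFinOrder x := by
  rw [isOfFinOrder_iff_pow_eq_one]
  rintro ⟨n, hn, hx⟩
  have h1 := mul_zpow_val_comm h n
  rw [zpow_natCast, zpow_natCast, hx] at h1
  simp only [GroupLike.val_one, mul_one, one_mul] at h1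
  refine hq ⟨n, hn, Units.ext ?_⟩
  have h2 : (((q ^ n : kˣ) : k) - 1) • y = 0 := by rw [sub_smul, one_smul, ← h1, sub_self]
  exact sub_eq_zero.1 ((smul_eq_zero.1 h2).resolve_right hy)

lemma pow_mul_val_comm {x : GroupLike k H} {y : H} {q : kˣ}
    (h : y * x.val = (q : k) • (x.val * y)) (n : ℕ) :
    y ^ n * x.val = ((q ^ n : kˣ) : k) • (x.val * y ^ n) := by
  induction n with
  | zero => simp
  | succ n ih =>
    rw [pow_succ, mul_assoc, h, mul_smul_comm, ← mul_assoc, ih, smul_mul_assoc, smul_smul,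
      mul_assoc, pow_succ, Units.val_mul, mul_comm]

variable {x : GroupLike k H} {y : Fin 2 → H} {q : Fin 2 → kˣ} {d : Fin 2 → ℤ}

/-- If no nontrivial twist is equal to one, then two skew primitive elements generate a free
algebra. -/
lemma linearIndependent_of_twist_ne_one (hx : ¬ IsOfFinOrder x)
    (hcomm : ∀ i, y i * x.val = (q i : k) • (x.val * y i))
    (hcomul : ∀ i, Coalgebra.comul (R := k) (y i) = y i ⊗ₜ[k] 1 + (x ^ d i).val ⊗ₜ[k] y i)
    (hind : LinearIndependent k fun i => (groupLikeSpan k H).mkQ (y i))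
    (htwist : ∀ M₁ M₂ : ℤ, 0 ≤ M₁ → 0 ≤ M₂ → 2 ≤ M₁ + M₂ →
      q 0 ^ (d 0 * (M₁ * (M₁ - 1)) + d 1 * (M₁ * M₂)) *
        q 1 ^ (d 1 * (M₂ * (M₂ - 1)) + d 0 * (M₁ * M₂)) ≠ 1) :
    LinearIndependent k fun w : List (Fin 2) => (w.map y).prod := by
  have h := linearIndependent_words hx hcomm hcomul hind (P := fun _ => True) (by simp)
    (fun n hn R hR hprim => hprim.eq_zero (by simp) (by simp) 0 hn
      (fun w _ hw h => by
        rw [← inv_eq_one, antipodeCoeff_mul_reverse_fin_two] at h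
        have := count_zero_add_count_one w
        exact absurd h (htwist _ _ (by positivity) (by positivity) (by omega))) hR)
  exact h.comp (fun w => ⟨w, trivial⟩) fun _ _ h => by simpa using h

/-- Raising the twist to the order-killing power `m` removes `q 0`. If the letter 1 occurs, the
remaining exponent of `q 1` is nonzero, as $d_0,d_1$ have the same sign. -/
lemma eq_replicate_of_antipodeCoeff_mul_eq_one (hq₀ : IsUnityRoot (q 0)) (hq₁ : ¬ IsUnityRoot (q 1))
    (hd : 0 < d 0 * d 1) {w : List (Fin 2)} (hw : 2 ≤ w.length)
    (h : antipodeCoeff q d w 0 * antipodeCoeff q d w.reverse 0 = 1) :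
    w = List.replicate w.length 0 := by
  rw [← inv_eq_one, antipodeCoeff_mul_reverse_fin_two] at h
  have hcount := count_zero_add_count_one w
  suffices h1 : w.count 1 = 0 by
    rw [List.eq_replicate_iff]
    refine ⟨rfl, fun b hb => ?_⟩
    have : b ≠ 1 := by rintro rfl; exact List.count_eq_zero.1 h1 hb
    omega
  by_contra h1
  obtain ⟨m, hm, hqm⟩ := hq₀
  set M₁ : ℤ := ((w.count 0 : ℕ) : ℤ)
  set M₂ : ℤ := ((w.count 1 : ℕ) : ℤ)
  have hM₁ : 0 ≤ M₁ := by positivity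
  have hM₂ : 1 ≤ M₂ := by omega
  have hM : 2 ≤ M₁ + M₂ := by omega
  refine hq₁ (IsUnityRoot.of_zpow_eq_one
    (a := (d 1 * (M₂ * (M₂ - 1)) + d 0 * (M₁ * M₂)) * m) ?_ ?_)
  · refine mul_ne_zero ?_ (by exact_mod_cast hm.ne')
    intro h0
    -- Multiplying by `d 1` makes both summands nonnegative.
    have h2 : M₂ * (d 1 * d 1 * (M₂ - 1) + d 0 * d 1 * M₁) = 0 := by
      linear_combination d 1 * h0
    have hd1 : 0 < d 1 * d 1 := mul_self_pos.2 (by rintro h; simp [h] at hd)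
    have h3 := (mul_eq_zero.1 h2).resolve_left (by omega)
    have h4 : 0 ≤ d 1 * d 1 * (M₂ - 1) := mul_nonneg hd1.le (by omega)
    have h5 : 0 ≤ d 0 * d 1 * M₁ := mul_nonneg hd.le hM₁
    have h6 : d 1 * d 1 * (M₂ - 1) = 0 := by omega
    have h7 : d 0 * d 1 * M₁ = 0 := by omega
    have := (mul_eq_zero.1 h6).resolve_left hd1.ne'
    have := (mul_eq_zero.1 h7).resolve_left hd.ne'
    omega
  · have := congr_arg (· ^ (m : ℤ)) h
    simp only [mul_zpow, one_zpow] at this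
    rw [← zpow_mul, ← zpow_mul, mul_comm _ (m : ℤ), zpow_mul, zpow_natCast, hqm, one_zpow,
      one_mul] at this
    exact this

lemma linearIndependent_of_isUnityRoot (hx : ¬ IsOfFinOrder x)
    (hcomm : ∀ i, y i * x.val = (q i : k) • (x.val * y i))
    (hcomul : ∀ i, Coalgebra.comul (R := k) (y i) = y i ⊗ₜ[k] 1 + (x ^ d i).val ⊗ₜ[k] y i)
    (hind : LinearIndependent k fun i => (groupLikeSpan k H).mkQ (y i))
    (hq₀ : IsUnityRoot (q 0)) (hq₁ : ¬ IsUnityRoot (q 1)) (hd : 0 < d 0 * d 1)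
    {P : List (Fin 2) → Prop} (hrev : ∀ w, P w → P w.reverse)
    (happ : ∀ u v, P (u ++ v) → P u ∧ P v)
    (hred : ∀ w, ¬ P w → (w.map y).prod ∈ wordFiltration x y w.length)
    (hP : ∀ n, 2 ≤ n → P (List.replicate n 0) →
      ∑ j ∈ Finset.range n, ((q 0 ^ d 0 : kˣ) : k) ^ j ≠ 0) :
    LinearIndependent k fun w : {w // P w} => (w.1.map y).prod := by
  refine linearIndependent_words hx hcomm hcomul hind hred
    (fun n hn R hR hprim => hprim.eq_zero hrev happ 0 hn (fun w hw hlen h => ?_) hR)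
  have hw' := eq_replicate_of_antipodeCoeff_mul_eq_one hq₀ hq₁ hd (hlen ▸ hn) h
  rw [hlen] at hw'
  exact ⟨hw', hP n hn (hw' ▸ hw)⟩

lemma linearIndependent_of_zpow_eq_one [CharZero k] (hx : ¬ IsOfFinOrder x)
    (hcomm : ∀ i, y i * x.val = (q i : k) • (x.val * y i))
    (hcomul : ∀ i, Coalgebra.comul (R := k) (y i) = y i ⊗ₜ[k] 1 + (x ^ d i).val ⊗ₜ[k] y i)
    (hind : LinearIndependent k fun i => (groupLikeSpan k H).mkQ (y i))
    (hq₀ : q 0 ^ d 0 = 1) (hq₁ : ¬ IsUnityRoot (q 1)) (hd : 0 < d 0 * d 1) :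
    LinearIndependent k fun w : List (Fin 2) => (w.map y).prod := by
  have hd0 : d 0 ≠ 0 := by rintro h; simp [h] at hd
  have h := linearIndependent_of_isUnityRoot hx hcomm hcomul hind (.of_zpow_eq_one hd0 hq₀) hq₁ hd
    (P := fun _ => True) (by simp) (by simp) (by simp) (fun n hn _ => by
      simp only [hq₀, Units.val_one, one_pow, Finset.sum_const, Finset.card_range, nsmul_one]
      exact_mod_cast (by omega : n ≠ 0))
  exact h.comp (fun w => ⟨w, trivial⟩) fun _ _ h => by simpa using h

/-- If $g\ne1,h$ occurs in $s$ with coefficient $c_g$, applying its dual functional to the left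
tensor factor yields $c_g g=c_g 1$, a contradiction. -/
lemma mem_span_pair_of_mem_groupLikeSpan {s : H} (hs : s ∈ groupLikeSpan k H) (h : GroupLike k H)
    (hcomul : Coalgebra.comul (R := k) s = s ⊗ₜ[k] 1 + h.val ⊗ₜ[k] s) :
    s ∈ Submodule.span k {(1 : H), h.val} := by
  classical
  have hrange : {a : H | IsGroupLikeElem k a} = Set.range (GroupLike.val (R := k) (A := H)) := by
    ext a
    exact ⟨fun ha => ⟨⟨a, ha⟩, rfl⟩, by rintro ⟨g, rfl⟩; exact g.isGroupLikeElem_val⟩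
  rw [groupLikeSpan, hrange, Finsupp.mem_span_range_iff_exists_finsupp] at hs
  obtain ⟨c, rfl⟩ := hs
  refine Submodule.sum_mem _ fun g hg => ?_
  by_cases h1 : g = 1
  · exact Submodule.smul_mem _ _ (Submodule.subset_span (by simp [h1]))
  by_cases hh : g = h
  · exact Submodule.smul_mem _ _ (Submodule.subset_span (by simp [hh]))
  exfalso
  obtain ⟨f, hf⟩ := (linearIndep_groupLikeVal (R := k) (A := H)).exists_dual_single g
  have hsum : ∀ F : GroupLike k H → H, (c.sum fun g' r => (r * if g' = g then 1 else 0) • F g') =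
      c g • F g := by
    intro F
    rw [Finsupp.sum, Finset.sum_eq_single g (by intros; simp_all) (by simp_all)]
    simp
  have hfs : f (c.sum fun g' r => r • g'.val) = c g := by
    rw [map_finsuppSum, Finsupp.sum, Finset.sum_eq_single g (by intros; simp_all) (by simp_all)]
    simp [hf]
  have key := congr_arg ((TensorProduct.lid k H).toLinearMap ∘ₗ f.rTensor H) hcomul
  simp only [LinearMap.comp_apply, map_add, LinearMap.rTensor_tmul, LinearEquiv.coe_coe,
    TensorProduct.lid_tmul, hf, if_neg (Ne.symm hh), zero_smul, add_zero, hfs] at key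
  rw [map_finsuppSum, map_finsuppSum, map_finsuppSum] at key
  have h2 : c g • g.val = c g • (1 : H) := by
    rw [← key, ← hsum]
    refine Finsupp.sum_congr fun g' _ => ?_
    rw [map_smul, map_smul, map_smul, g'.isGroupLikeElem_val.comul_eq_tmul_self,
      LinearMap.rTensor_tmul, TensorProduct.lid_tmul, hf, smul_smul]
  have h3 : g.val = (1 : GroupLike k H).val :=
    smul_right_injective H (Finsupp.mem_support_iff.1 hg) h2
  exact h1 (GroupLike.val_injective h3)

lemma comul_pow_of_orderOf {ι : Type*} {y : ι → H} {q : ι → kˣ} {d : ι → ℤ}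
    (hcomm : ∀ i, y i * x.val = (q i : k) • (x.val * y i))
    (hcomul : ∀ i, Coalgebra.comul (R := k) (y i) = y i ⊗ₜ[k] 1 + (x ^ d i).val ⊗ₜ[k] y i)
    (i : ι) (h1 : q i ^ d i ≠ 1) (hfin : 0 < orderOf (q i ^ d i)) :
    Coalgebra.comul (R := k) (y i ^ orderOf (q i ^ d i)) =
      (y i ^ orderOf (q i ^ d i)) ⊗ₜ[k] 1 +
        (x ^ (orderOf (q i ^ d i) * d i)).val ⊗ₜ[k] (y i ^ orderOf (q i ^ d i)) := by
  have hQ : orderOf ((q i ^ d i : kˣ) : k) = orderOf (q i ^ d i) := orderOf_units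
  have hw := comul_word hcomm hcomul (List.replicate (orderOf (q i ^ d i)) i)
  rw [wordComul_replicate_eq q d i
    (by rw [← hQ]; exact geom_sum_orderOf_eq_zero (by simpa [Units.ext_iff] using h1)) hfin
    (fun m hm hlt => geom_sum_ne_zero_of_lt_orderOf hm (by rwa [hQ])), map_add] at hw
  simpa [powWord, wordWeight] using hw

lemma word_mul_zpow {ι : Type*} {y : ι → H} {q : ι → kˣ}
    (hcomm : ∀ i, y i * x.val = (q i : k) • (x.val * y i)) (w : List ι) (a : ℤ) :
    ∃ c : k, (w.map y).prod * (x ^ a).val = c • ((x ^ a).val * (w.map y).prod) := by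
  induction w with
  | nil => exact ⟨1, by simp⟩
  | cons i w ih =>
    obtain ⟨c, hc⟩ := ih
    refine ⟨c * ((q i ^ a : kˣ) : k), ?_⟩
    rw [List.map_cons, List.prod_cons, mul_assoc, hc, mul_smul_comm, ← mul_assoc,
      mul_zpow_val_comm (hcomm i), smul_mul_assoc, smul_smul, mul_assoc]

/-- Replacing $y_i^N$ by $\alpha+\beta x^a$ and moving $x^a$ to the front leaves multiples of a word
shorter by $N$. -/
lemma word_mem_wordFiltration_of_infix {ι : Type*} {y : ι → H} {q : ι → kˣ}
    (hcomm : ∀ i, y i * x.val = (q i : k) • (x.val * y i)) {i : ι} {N : ℕ} (hN : 0 < N) {a : ℤ}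
    (h : y i ^ N ∈ Submodule.span k {(1 : H), (x ^ a).val}) {w : List ι}
    (hw : List.replicate N i <:+: w) : (w.map y).prod ∈ wordFiltration x y w.length := by
  obtain ⟨u, v, rfl⟩ := hw
  obtain ⟨α, β, hαβ⟩ := Submodule.mem_span_pair.1 h
  obtain ⟨c, hc⟩ := word_mul_zpow hcomm u a
  have hmem : ∀ b, powWord x y (b, u ++ v) ∈
      wordFiltration x y (u ++ List.replicate N i ++ v).length := fun b =>
    powWord_mem_wordFiltration x y (by simp; omega)
  have heq : ((u ++ List.replicate N i ++ v).map y).prod =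
      α • powWord x y (0, u ++ v) + (β * c) • powWord x y (a, u ++ v) := by
    simp only [List.map_append, List.prod_append, List.map_replicate, List.prod_replicate,
      ← hαβ, powWord, zpow_zero, GroupLike.val_one, one_mul]
    rw [mul_add, add_mul, mul_smul_comm, mul_smul_comm, mul_one, hc, smul_smul, smul_mul_assoc,
      smul_mul_assoc, mul_assoc]
  rw [heq]
  exact add_mem (Submodule.smul_mem _ _ (hmem 0)) (Submodule.smul_mem _ _ (hmem a))

/-- The code sending the letters `0`, `1` to the words `1` and `01`. -/
def spacedCode : Fin 2 → List (Fin 2) := ![[1], [0, 1]]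

lemma spacedCode_zero : spacedCode 0 = [1] := rfl

lemma spacedCode_one : spacedCode 1 = [0, 1] := rfl

/-- In a concatenation of code words every 0 is followed at once by a 1. -/
lemma spacedCode_flatMap_ne (w p t : List (Fin 2)) : w.flatMap spacedCode ≠ p ++ 0 :: 0 :: t := by
  induction w generalizing p with
  | nil => simp
  | cons i w ih =>
    fin_cases i
    · rcases p with _ | ⟨a, p⟩
      · simp [spacedCode]
      · simpa [spacedCode] using fun _ => ih p
    · rcases p with _ | ⟨a, _ | ⟨b, p⟩⟩
      · simp [spacedCode]
      · simp [spacedCode]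
      · simpa [spacedCode] using fun _ _ => ih p

lemma spacedCode_flatMap_injective :
    Function.Injective fun w : List (Fin 2) => w.flatMap spacedCode := by
  intro w
  induction w with
  | nil =>
    intro w' h
    rcases w' with _ | ⟨i, w'⟩
    · rfl
    · fin_cases i <;> simp [spacedCode] at h
  | cons i w ih =>
    intro w' h
    rcases w' with _ | ⟨j, w'⟩
    · fin_cases i <;> simp [spacedCode] at h
    · fin_cases i <;> fin_cases j <;> simp [spacedCode] at h ⊢ <;> exact ih h

lemma not_replicate_infix_spacedCode {N : ℕ} (hN : 2 ≤ N) (w : List (Fin 2)) :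
    ¬ List.replicate N 0 <:+: w.flatMap spacedCode := by
  rintro ⟨p, t, h⟩
  obtain ⟨m, rfl⟩ : ∃ m, N = m + 2 := ⟨N - 2, by omega⟩
  exact spacedCode_flatMap_ne w p (List.replicate m 0 ++ t) (by
    rw [← h]; simp [List.replicate_succ])

lemma prod_map_spacedCode (y : Fin 2 → H) (w : List (Fin 2)) :
    ((w.flatMap spacedCode).map y).prod = (w.map ![y 1, y 0 * y 1]).prod := by
  induction w with
  | nil => simp
  | cons i w ih => fin_cases i <;> simp [spacedCode_zero, spacedCode_one, ih, mul_assoc]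

/-- Commutation with $x$ separates the two: $q_0^N$ is a root of unity and $q_1$ is not, so they are
different eigenvalues. -/
lemma linearIndependent_pow_pair (hcomm : ∀ i, y i * x.val = (q i : k) • (x.val * y i))
    (hind : LinearIndependent k fun i => (groupLikeSpan k H).mkQ (y i))
    (hq₀ : IsUnityRoot (q 0)) (hq₁ : ¬ IsUnityRoot (q 1)) {N : ℕ}
    (hN : y 0 ^ N ∉ groupLikeSpan k H) :
    LinearIndependent k fun i => (groupLikeSpan k H).mkQ (![y 0 ^ N, y 1] i) := by
  have hpow := pow_mul_val_comm (hcomm 0) N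
  have hy1 : y 1 ∉ groupLikeSpan k H := fun h =>
    hind.ne_zero 1 ((Submodule.Quotient.mk_eq_zero _).2 h)
  have hfun : (fun i => (groupLikeSpan k H).mkQ (![y 0 ^ N, y 1] i)) =
      ![(groupLikeSpan k H).mkQ (y 0 ^ N), (groupLikeSpan k H).mkQ (y 1)] := by
    ext i; fin_cases i <;> rfl
  rw [hfun, LinearIndependent.pair_iff]
  intro s t hst
  rw [← map_smul, ← map_smul, ← map_add, Submodule.mkQ_apply, Submodule.Quotient.mk_eq_zero] at hst
  have hne : ((q 1 : k) - ((q 0 ^ N : kˣ) : k)) ≠ 0 := by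
    rw [sub_ne_zero]
    intro h
    obtain ⟨m, hm, hqm⟩ := hq₀
    exact hq₁ ⟨m, hm, by rw [Units.ext h, ← pow_mul, mul_comm, pow_mul, hqm, one_pow]⟩
  have h1 : x.val * (t • y 1) ∈ groupLikeSpan k H := by
    have h2 := sub_mem (mem_groupLikeSpan_mul x hst)
      (Submodule.smul_mem _ ((q 0 ^ N : kˣ) : k) (mul_mem_groupLikeSpan x hst))
    -- This twisted commutator cancels the `y 0 ^ N` part and stays inside $C_0$.
    have h3 : (s • y 0 ^ N + t • y 1) * x.val -
        ((q 0 ^ N : kˣ) : k) • (x.val * (s • y 0 ^ N + t • y 1)) =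
        ((q 1 : k) - ((q 0 ^ N : kˣ) : k)) • (x.val * (t • y 1)) := by
      rw [add_mul, smul_mul_assoc, smul_mul_assoc, hpow, hcomm, mul_add, mul_smul_comm,
        mul_smul_comm]
      module
    rw [h3] at h2
    exact (Submodule.smul_mem_iff _ hne).1 h2
  have h2 : t • y 1 ∈ groupLikeSpan k H := by
    have := mul_mem_groupLikeSpan x⁻¹ h1
    rwa [← mul_assoc, ← GroupLike.val_mul, inv_mul_cancel, GroupLike.val_one, one_mul] at this
  have ht : t = 0 := by
    by_contra ht
    exact hy1 ((Submodule.smul_mem_iff _ ht).1 h2)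
  subst ht
  refine ⟨?_, rfl⟩
  by_contra hs
  rw [zero_smul, add_zero] at hst
  exact hN ((Submodule.smul_mem_iff _ hs).1 hst)

lemma free_of_isUnityRoot [CharZero k] (hx : ¬ IsOfFinOrder x)
    (hcomm : ∀ i, y i * x.val = (q i : k) • (x.val * y i))
    (hcomul : ∀ i, Coalgebra.comul (R := k) (y i) = y i ⊗ₜ[k] 1 + (x ^ d i).val ⊗ₜ[k] y i)
    (hind : LinearIndependent k fun i => (groupLikeSpan k H).mkQ (y i))
    (hne : q 0 ^ d 0 ≠ 1) (hroot : IsUnityRoot (q 0 ^ d 0)) (hq₁ : ¬ IsUnityRoot (q 1))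
    (hd : 0 < d 0 * d 1) :
    ∃ a b : H, LinearIndependent k fun w : List (Fin 2) => (w.map ![a, b]).prod := by
  have hd0 : d 0 ≠ 0 := by rintro h; simp [h] at hd
  have hq₀ : IsUnityRoot (q 0) := by
    obtain ⟨n, hn, h⟩ := hroot
    refine .of_zpow_eq_one (a := d 0 * n) (mul_ne_zero hd0 (by exact_mod_cast hn.ne')) ?_
    rw [zpow_mul, zpow_natCast, h]
  set N := orderOf (q 0 ^ d 0) with hNdef
  have hN0 : 0 < N := by
    obtain ⟨n, hn, h⟩ := hroot
    exact orderOf_pos_iff.2 (isOfFinOrder_iff_pow_eq_one.2 ⟨n, hn, h⟩)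
  have hN1 : N ≠ 1 := by rwa [hNdef, Ne, orderOf_eq_one_iff]
  have hcomulN := comul_pow_of_orderOf hcomm hcomul 0 hne hN0
  rw [← hNdef] at hcomulN
  by_cases hmem : y 0 ^ N ∈ groupLikeSpan k H
  · refine ⟨y 1, y 0 * y 1, ?_⟩
    have hspan := mem_span_pair_of_mem_groupLikeSpan hmem _ hcomulN
    have hli := linearIndependent_of_isUnityRoot hx hcomm hcomul hind hq₀ hq₁ hd
      (P := fun w => ¬ List.replicate N 0 <:+: w)
      (fun w hw h => hw (by
        have := List.reverse_infix.2 h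
        rwa [List.reverse_reverse, List.reverse_replicate] at this))
      (fun u v huv => ⟨fun h => huv (h.trans (List.infix_append' [] u v)),
        fun h => huv (h.trans (List.suffix_append u v).isInfix)⟩)
      (fun w hw => word_mem_wordFiltration_of_infix hcomm hN0 hspan (not_not.1 hw))
      -- A power $0^n$ avoiding $0^N$ has $n<N$, the order of $Q$, so $[n]\neq0$.
      (fun n hn hPn => by
        refine geom_sum_ne_zero_of_lt_orderOf (by omega) ?_
        rw [orderOf_units, ← hNdef]
        by_contra hle
        refine hPn ⟨[], List.replicate (n - N) 0, ?_⟩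
        rw [List.nil_append, List.replicate_append_replicate]
        congr 1
        omega)
    have := hli.comp (fun w : List (Fin 2) =>
      ⟨w.flatMap spacedCode, not_replicate_infix_spacedCode (by omega) w⟩)
      (fun w w' h => spacedCode_flatMap_injective (congr_arg Subtype.val h))
    simpa only [Function.comp_def, prod_map_spacedCode] using this
  · refine ⟨y 0 ^ N, y 1, ?_⟩
    -- For $y_0^N$ the new parameter is $(q_0^N)^{Nd_0}=Q^{N^2}=1$.
    refine linearIndependent_of_zpow_eq_one (q := ![q 0 ^ N, q 1]) (d := ![N * d 0, d 1]) hx ?_ ?_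
      (linearIndependent_pow_pair hcomm hind hq₀ hq₁ hmem) ?_ (by simpa using hq₁) ?_
    · intro i
      fin_cases i
      · exact pow_mul_val_comm (hcomm 0) N
      · exact hcomm 1
    · intro i
      fin_cases i
      · simpa using hcomulN
      · simpa using hcomul 1
    · simp only [Matrix.cons_val_zero]
      rw [← zpow_natCast, ← zpow_mul, show (N : ℤ) * (N * d 0) = d 0 * N * N by ring, zpow_mul,
        zpow_mul, zpow_natCast, zpow_natCast, hNdef, pow_orderOf_eq_one, one_pow]
    · simp only [Matrix.cons_val_zero, Matrix.cons_val_one, mul_assoc]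
      positivity

end SkewPrimitivePairs

theorem proposition3p3 {k H : Type*} [Field k] [IsAlgClosed k] [CharZero k]
    [Ring H] [HopfAlgebra k H]
    (y₁ y₂ : H) (x : GroupLike k H) (d₁ d₂ : ℤ) (q₁ q₂ : kˣ)
    (hindep : LinearIndependent k
      ![(groupLikeSpan k H).mkQ y₁, (groupLikeSpan k H).mkQ y₂])
    (hy₁ : IsSkewPrimitive k (x ^ d₁) y₁)
    (hy₂ : IsSkewPrimitive k (x ^ d₂) y₂)
    (hq₁ : y₁ * x.val = (q₁ : k) • (x.val * y₁))
    (hq₂ : y₂ * x.val = (q₂ : k) • (x.val * y₂)) :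
    (¬ IsOfFinOrder x → ¬ HasFreeSubalgebraRankTwo k H →
      ∃ M₁ M₂ : ℤ, 0 ≤ M₁ ∧ 0 ≤ M₂ ∧ 2 ≤ M₁ + M₂ ∧
        q₁ ^ (d₁ * (M₁ * (M₁ - 1)) + d₂ * (M₁ * M₂)) *
          q₂ ^ (d₂ * (M₂ * (M₂ - 1)) + d₁ * (M₁ * M₂)) = 1) ∧
    (((q₁ = q₂ ∧ ¬ IsUnityRoot q₁ ∧ 0 < d₁ * d₂) ∨
      (q₁ ^ d₁ = 1 ∧ ¬ IsUnityRoot q₂ ∧ 0 < d₁ * d₂) ∨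
      (q₁ ^ d₁ ≠ 1 ∧ IsUnityRoot (q₁ ^ d₁) ∧ ¬ IsUnityRoot q₂ ∧ 0 < d₁ * d₂) ∨
      (GeneratesFreeAbelianRankTwo q₁ q₂ ∧ d₁ * d₂ ≠ 0)) →
      HasFreeSubalgebraRankTwo k H ∧ HasExponentialGrowth k H) := by
  have hcomm : ∀ i, ![y₁, y₂] i * x.val = (![q₁, q₂] i : k) • (x.val * ![y₁, y₂] i) := by
    intro i; fin_cases i
    · exact hq₁
    · exact hq₂
  have hcomul : ∀ i, Coalgebra.comul (R := k) (![y₁, y₂] i) =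
      ![y₁, y₂] i ⊗ₜ[k] 1 + (x ^ ![d₁, d₂] i).val ⊗ₜ[k] ![y₁, y₂] i := by
    intro i; fin_cases i
    · exact hy₁.comul_eq
    · exact hy₂.comul_eq
  have hind : LinearIndependent k fun i => (groupLikeSpan k H).mkQ (![y₁, y₂] i) := by
    convert hindep using 1
    ext i; fin_cases i <;> rfl
  have hfin₁ := not_isOfFinOrder_of_not_isUnityRoot hy₁.ne_zero hq₁
  have hfin₂ := not_isOfFinOrder_of_not_isUnityRoot hy₂.ne_zero hq₂
  refine ⟨fun hx hfree => ?_, ?_⟩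
  · by_contra hM
    push Not at hM
    exact hfree (hasFreeSubalgebra_and_growth
      (linearIndependent_of_twist_ne_one hx hcomm hcomul hind hM)).1
  · rintro (⟨rfl, hq, hd⟩ | ⟨h1, hq, hd⟩ | ⟨hne, hroot, hq, hd⟩ | ⟨hgen, hd⟩)
    · refine hasFreeSubalgebra_and_growth (linearIndependent_of_twist_ne_one (hfin₁ hq) hcomm hcomul
        hind fun M₁ M₂ hM₁ hM₂ hM h => hq ?_)
      simp only [Matrix.cons_val_zero, Matrix.cons_val_one] at h
      rw [← zpow_add] at h
      refine .of_zpow_eq_one ?_ h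
      -- With $q_1=q_2$ the total exponent factors as weight times length minus one; equal signs of
      -- $d_1,d_2$ keep the weight nonzero.
      rw [show d₁ * (M₁ * (M₁ - 1)) + d₂ * (M₁ * M₂) + (d₂ * (M₂ * (M₂ - 1)) + d₁ * (M₁ * M₂)) =
        (d₁ * M₁ + d₂ * M₂) * (M₁ + M₂ - 1) by ring]
      refine mul_ne_zero (fun h0 => ?_) (by omega)
      have hd₁ : d₁ ≠ 0 := by rintro rfl; simp at hd
      have h2 : d₁ * d₁ * M₁ + d₁ * d₂ * M₂ = 0 := by linear_combination d₁ * h0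
      have hpos : 0 < d₁ * d₁ := mul_self_pos.2 hd₁
      have h4 : 0 ≤ d₁ * d₁ * M₁ := mul_nonneg hpos.le hM₁
      have h5 : 0 ≤ d₁ * d₂ * M₂ := mul_nonneg hd.le hM₂
      have h6 : d₁ * d₁ * M₁ = 0 := by omega
      have h7 : d₁ * d₂ * M₂ = 0 := by omega
      have := (mul_eq_zero.1 h6).resolve_left hpos.ne'
      have := (mul_eq_zero.1 h7).resolve_left hd.ne'
      omega
    · exact hasFreeSubalgebra_and_growth
        (linearIndependent_of_zpow_eq_one (hfin₂ hq) hcomm hcomul hind h1 hq hd)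
    · obtain ⟨a, b, h⟩ := free_of_isUnityRoot (hfin₂ hq) hcomm hcomul hind hne hroot hq hd
      exact hasFreeSubalgebra_and_growth h
    · have hq : ¬ IsUnityRoot q₁ := by
        rintro ⟨n, hn, h⟩
        have := (hgen.eq_zero (a := n) (b := 0) (by simpa using h)).1
        omega
      refine hasFreeSubalgebra_and_growth (linearIndependent_of_twist_ne_one (hfin₁ hq) hcomm hcomul
        hind fun M₁ M₂ hM₁ hM₂ hM h => hd ?_)
      simp only [Matrix.cons_val_zero, Matrix.cons_val_one] at h
      obtain ⟨e1, e2⟩ := hgen.eq_zero h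
      have e3 : M₁ * (d₁ * (M₁ - 1) + d₂ * M₂) = 0 := by linear_combination e1
      have e4 : M₂ * (d₂ * (M₂ - 1) + d₁ * M₁) = 0 := by linear_combination e2
      rcases mul_eq_zero.1 e3 with h0 | h1
      · subst h0
        have := (mul_eq_zero.1 e4).resolve_left (by omega)
        rw [mul_zero, add_zero] at this
        rw [(mul_eq_zero.1 this).resolve_right (by omega), mul_zero]
      rcases mul_eq_zero.1 e4 with h0 | h2
      · subst h0
        rw [mul_zero, add_zero] at h1
        rw [(mul_eq_zero.1 h1).resolve_right (by omega), zero_mul]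
      -- The two equations are linear in $(d_1,d_2)$ with determinant
      -- $(M_1-1)(M_2-1)-M_1M_2=1-M_1-M_2\neq0$.
      · have : d₁ * d₂ * (M₁ + M₂ - 1) = 0 := by
          linear_combination d₂ * M₂ * h2 - d₂ * (M₂ - 1) * h1
        exact (mul_eq_zero.1 this).resolve_right (by omega)
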